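/- All manifolds are real, smooth, finite-dimensional and Hausdorff. Let $q\colon G\to B$ be a group bundle, that is, a smooth locally trivial fibre bundle whose fibres $G_b=q^{-1}(b)$ carry group structures such that composition $G\times_B G\to G$, inversion $G\to G$ and the identity section $B\to G$ are smooth (the local trivializations are not assumed to be compatible with the group structures). Let $\mathcal L$ be a flat group connection on it, that is, an involutive smooth linear subbundle $\mathcal L\subset TG$ such that for every $g\in G$ the differential $d_gq$ maps $\mathcal L_g$ isomorphically onto $T_{q(g)}B$, and such that $\mathcal L$ is compatible with composition: the differential of $G\times_B G\to G$ maps every pair $(v,w)\in \mathcal L_g\times\mathcal L_h$ with $q(g)=q(h)$ and $dq(v)=dq(w)$ into $\mathcal L_{gh}$. Proposition. Assume that $B$ is simply connected (in particular, path connected), and let $x\in B$. Then the fibre $G_x$, with the smooth structure induced from $G$, is a Lie group, and $(G,\mathcal L)$ is isomorphic to $(G_x,0)\times(B,TB)$ as a bundle of groups with connection over $B$. That is, there is a diffeomorphism $\Phi\colon G_x\times B\to G$ such that 1. $q(\Phi(g,b))=b$ for all $g\in G_x$, $b\in B$; 2. $\Phi(gg',b)=\Phi(g,b)\,\Phi(g',b)$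 for all $g,g'\in G_x$, $b\in B$; 3. $\Phi$ and $\Phi^{-1}$ are morphisms of foliated manifolds: the differential $d_{(g,b)}\Phi$ maps $0\times T_bB$ onto $\mathcal L_{\Phi(g,b)}$ for all $(g,b)$, and the differential of $\Phi^{-1}$ maps $\mathcal L$ onto the foliation $0\times TB$. -/

import Mathlib

open Set Bundle
open scoped Manifold ContDiff Topology

noncomputable section

namespace GroupBundle

/-! ### Regular foliations

A distribution on a manifold `M` is a family `𝓓` of subspaces `𝓓 p ⊆ T_p M`. -/

section Foliation

variable {E : Type*} [NormedAddCommGroup E] [NormedSpace ℝ E]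
  {H : Type*} [TopologicalSpace H] (I : ModelWithCorners ℝ E H)
  {M : Type*} [TopologicalSpace M] [ChartedSpace H M]

/-- The vector field `X` is smooth on the set `U`. -/
def SmoothFieldOn [IsManifold I ∞ M] (X : Π p : M, TangentSpace I p) (U : Set M) : Prop :=
  ContMDiffOn I I.tangent ∞ (fun p => (⟨p, X p⟩ : TangentBundle I M)) U

/-- `𝓓` is a smooth linear subbundle of `TM`: near every point it is spanned by a smooth local
frame. -/
def IsSubbundle [IsManifold I ∞ M] (𝓓 : Π p : M, Submodule ℝ (TangentSpace I p)) : Prop :=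
  ∀ p : M, ∃ (U : Set M) (r : ℕ) (X : Fin r → Π y : M, TangentSpace I y),
    IsOpen U ∧ p ∈ U ∧ (∀ i, SmoothFieldOn I (X i) U) ∧
    ∀ y ∈ U, LinearIndependent ℝ (fun i => X i y) ∧
      Submodule.span ℝ (range fun i => X i y) = 𝓓 y

/-- `𝓓` is involutive: the Lie bracket of two smooth local sections of `𝓓` is a section
of `𝓓`. -/
def IsInvolutive [IsManifold I ∞ M] (𝓓 : Π p : M, Submodule ℝ (TangentSpace I p)) : Prop :=
  ∀ (U : Set M) (X Y : Π p : M, TangentSpace I p), IsOpen U →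
    SmoothFieldOn I X U → SmoothFieldOn I Y U →
    (∀ p ∈ U, X p ∈ 𝓓 p) → (∀ p ∈ U, Y p ∈ 𝓓 p) →
    ∀ p ∈ U, VectorField.mlieBracket I X Y p ∈ 𝓓 p

/-- A regular foliation: an involutive linear subbundle of `TM`. -/
structure IsFoliation [IsManifold I ∞ M] (𝓓 : Π p : M, Submodule ℝ (TangentSpace I p)) :
    Prop where
  subbundle : IsSubbundle I 𝓓
  involutive : IsInvolutive I 𝓓

variable {E' : Type*} [NormedAddCommGroup E'] [NormedSpace ℝ E']
  {H' : Type*} [TopologicalSpace H'] (I' : ModelWithCorners ℝ E' H')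
  {M' : Type*} [TopologicalSpace M'] [ChartedSpace H' M']

/-- A morphism of foliated manifolds `(M, 𝓓) → (M', 𝓓')`: a smooth map whose differential at each
`p` maps `𝓓 p` onto `𝓓' (f p)`. -/
def IsFoliatedMap (𝓓 : Π p : M, Submodule ℝ (TangentSpace I p))
    (𝓓' : Π p : M', Submodule ℝ (TangentSpace I' p)) (f : M → M') : Prop :=
  ContMDiff I I' ∞ f ∧ ∀ p, Submodule.map (mfderiv I I' f p).toLinearMap (𝓓 p) = 𝓓' (f p)

/-- The foliation of `(M, 0) × (M', TM')`. -/
def zeroProdTop (M M' : Type*) [TopologicalSpace M] [ChartedSpace H M]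
    [TopologicalSpace M'] [ChartedSpace H' M'] (p : M × M') :
    Submodule ℝ (TangentSpace (I.prod I') p) :=
  Submodule.prod (⊥ : Submodule ℝ (TangentSpace I p.1)) (⊤ : Submodule ℝ (TangentSpace I' p.2))

end Foliation

/-! ### Group bundles -/

section Bundle

variable {EB : Type*} [NormedAddCommGroup EB] [NormedSpace ℝ EB]
  {EF : Type*} [NormedAddCommGroup EF] [NormedSpace ℝ EF]
  {EG : Type*} [NormedAddCommGroup EG] [NormedSpace ℝ EG]
  {B : Type*} [TopologicalSpace B] [ChartedSpace EB B]
  (F : Type*) [TopologicalSpace F] [ChartedSpace EF F]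
  {G : Type*} [TopologicalSpace G] [ChartedSpace EG G]
  (q : G → B)

/-- The fibre `G_b`, as a subspace of `G`. -/
abbrev Fiber {B G : Type*} (q : G → B) (b : B) : Type _ := q ⁻¹' {b}

/-- `q : G → B` is a smooth fibre bundle with typical fibre `F`: over a neighbourhood of each
point of `B` there is a local trivialization which is a diffeomorphism. -/
def IsSmoothBundle : Prop :=
  ∀ b : B, ∃ e : Trivialization F q, b ∈ e.baseSet ∧
    ContMDiffOn 𝓘(ℝ, EG) (𝓘(ℝ, EB).prod 𝓘(ℝ, EF)) ∞ e e.source ∧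
    ContMDiffOn (𝓘(ℝ, EB).prod 𝓘(ℝ, EF)) 𝓘(ℝ, EG) ∞ e.toOpenPartialHomeomorph.symm e.target

/-- The set underlying the fibre product `G ×_B G`. -/
def fiberProd {B G : Type*} (q : G → B) : Set (G × G) := {p | q p.1 = q p.2}

open Classical in
/-- Fibrewise composition `G ×_B G → G`, with an irrelevant value off `G ×_B G`. -/
def fiberComp {B G : Type*} (q : G → B) [∀ b, Group (Fiber q b)] (p : G × G) : G :=
  if h : q p.1 = q p.2 then
    (((⟨p.1, h⟩ : Fiber q (q p.2)) * (⟨p.2, rfl⟩ : Fiber q (q p.2)) : Fiber q (q p.2)) : G)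
  else p.1

/-- A group bundle: a smooth bundle whose fibres are groups, such that composition
`G ×_B G → G`, inversion `G → G` and identity `B → G` are smooth. The fibre product is an
embedded submanifold of `G × G`, so that `ContMDiffOn` on it is smoothness on the submanifold. -/
structure IsGroupBundle [∀ b, Group (Fiber q b)] : Prop where
  bundle : IsSmoothBundle (EB := EB) (EF := EF) (EG := EG) F q
  smooth_comp : ContMDiffOn (𝓘(ℝ, EG).prod 𝓘(ℝ, EG)) 𝓘(ℝ, EG) ∞ (fiberComp q) (fiberProd q)
  smooth_inv : ContMDiff 𝓘(ℝ, EG) 𝓘(ℝ, EG) ∞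
    (fun g : G => (((⟨g, rfl⟩ : Fiber q (q g))⁻¹ : Fiber q (q g)) : G))
  smooth_one : ContMDiff 𝓘(ℝ, EB) 𝓘(ℝ, EG) ∞ (fun b : B => ((1 : Fiber q b) : G))

variable {F q}

/-- The homeomorphism of a fibre with the typical fibre, given by a smooth local trivialization. -/
def IsSmoothBundle.fiberHomeo
    (h : IsSmoothBundle (EB := EB) (EF := EF) (EG := EG) F q) (b : B) : Fiber q b ≃ₜ F :=
  (h b).choose.preimageSingletonHomeomorph (h b).choose_spec.1

/-- The smooth structure of the fibre `G_b` as a submanifold of `G`, obtained by identifying `G_b`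
with the typical fibre through a smooth local trivialization. By `contMDiff_fiber_iff` below it
does not depend on the trivialization: a map into `G_b` is smooth if and only if it is smooth as a
map into `G`. -/
@[reducible] def IsSmoothBundle.fiberChartedSpace
    (h : IsSmoothBundle (EB := EB) (EF := EF) (EG := EG) F q) (b : B) :
    ChartedSpace EF (Fiber q b) where
  atlas := (fun c => (h.fiberHomeo b).transOpenPartialHomeomorph c) '' atlas EF F
  chartAt p := (h.fiberHomeo b).transOpenPartialHomeomorph (chartAt EF (h.fiberHomeo b p))
  mem_chart_source p := by simp
  chart_mem_atlas p := mem_image_of_mem _ (chart_mem_atlas _ _)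

/-- The distribution of `G ×_B G` induced by a distribution `𝓛` of `G`: the pairs
`(v, w) ∈ 𝓛 × 𝓛` with the same projection to `TB`. -/
def fiberProdDist (q : G → B) (𝓛 : Π g : G, Submodule ℝ (TangentSpace 𝓘(ℝ, EG) g)) (p : G × G) :
    Set (TangentSpace (𝓘(ℝ, EG).prod 𝓘(ℝ, EG)) p) :=
  {u | u.1 ∈ 𝓛 p.1 ∧ u.2 ∈ 𝓛 p.2 ∧
    (mfderiv 𝓘(ℝ, EG) 𝓘(ℝ, EB) q p.1 u.1 : EB) = mfderiv 𝓘(ℝ, EG) 𝓘(ℝ, EB) q p.2 u.2}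

/-- A flat Ehresmann connection in `q : G → B`: a foliation of `G` whose tangent spaces are
mapped isomorphically onto those of `B`. -/
structure IsFlatConnection [IsManifold 𝓘(ℝ, EG) ∞ G] (q : G → B)
    (𝓛 : Π g : G, Submodule ℝ (TangentSpace 𝓘(ℝ, EG) g)) : Prop where
  foliation : IsFoliation 𝓘(ℝ, EG) 𝓛
  bijOn : ∀ g : G, BijOn (mfderiv 𝓘(ℝ, EG) 𝓘(ℝ, EB) q g) (𝓛 g) univ

/-- A flat group connection in a group bundle: a flat Ehresmann connection `𝓛` compatible with
composition, that is, the differential of `G ×_B G → G` maps the induced foliation of `G ×_B G`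
into `𝓛`. All derivatives of `fiberComp q` within the submanifold `G ×_B G` agree on its tangent
vectors, so that the use of `mfderivWithin` involves no choice here. -/
structure IsGroupConnection [IsManifold 𝓘(ℝ, EG) ∞ G] (q : G → B) [∀ b, Group (Fiber q b)]
    (𝓛 : Π g : G, Submodule ℝ (TangentSpace 𝓘(ℝ, EG) g)) : Prop where
  flat : IsFlatConnection (EB := EB) q 𝓛
  comp_mem : ∀ p ∈ fiberProd q, ∀ u ∈ fiberProdDist (EB := EB) q 𝓛 p,
    mfderivWithin (𝓘(ℝ, EG).prod 𝓘(ℝ, EG)) 𝓘(ℝ, EG) (fiberComp q) (fiberProd q) p u ∈ 𝓛 (fiberComp q p)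

section FiberSmooth

variable {E : Type*} [NormedAddCommGroup E] [NormedSpace ℝ E]
  {H : Type*} [TopologicalSpace H] {I : ModelWithCorners ℝ E H}
  {M : Type*} [TopologicalSpace M] [ChartedSpace H M]

theorem contMDiff_fiberHomeo_comp_iff
    (h : IsSmoothBundle (EB := EB) (EF := EF) (EG := EG) F q) (b : B) (f : M → Fiber q b) :
    (letI := h.fiberChartedSpace b; ContMDiff I 𝓘(ℝ, EF) ∞ f) ↔
      ContMDiff I 𝓘(ℝ, EF) ∞ (fun x => h.fiberHomeo b (f x)) := by
  let _ := h.fiberChartedSpace b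
  refine forall_congr' fun x => ?_
  rw [contMDiffAt_iff, contMDiffAt_iff]
  exact and_congr ((h.fiberHomeo b).comp_continuousAt_iff f x).symm Iff.rfl

/-- The smooth structure of `G_b` is the one induced from `G`. -/
theorem contMDiff_fiber_iff
    (h : IsSmoothBundle (EB := EB) (EF := EF) (EG := EG) F q) (b : B) (f : M → Fiber q b) :
    (letI := h.fiberChartedSpace b; ContMDiff I 𝓘(ℝ, EF) ∞ f) ↔
      ContMDiff I 𝓘(ℝ, EG) ∞ (fun x => (f x : G)) := by
  rw [contMDiff_fiberHomeo_comp_iff]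
  obtain ⟨hb, he, he'⟩ := (h b).choose_spec
  have hs : ∀ y : Fiber q b, (y : G) ∈ (h b).choose.source := fun y => by
    rw [Trivialization.mem_source, show q y = b from y.2]; exact hb
  constructor
  · intro hf
    have h1 : ContMDiff I (𝓘(ℝ, EB).prod 𝓘(ℝ, EF)) ∞ (fun x => (b, h.fiberHomeo b (f x))) :=
      contMDiff_const.prodMk hf
    have h2 := he'.comp_contMDiff h1 (fun x => by
      rw [Trivialization.mem_target]; exact hb)
    refine h2.congr fun x => ?_
    have : (b, h.fiberHomeo b (f x)) = (h b).choose (f x : G) := by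
      refine Prod.ext ?_ rfl
      rw [Trivialization.coe_fst _ (hs _)]
      exact (f x).2.symm
    simp only [Function.comp_apply, this]
    exact ((h b).choose.toOpenPartialHomeomorph.left_inv (hs _)).symm
  · intro hf
    have h1 : ContMDiff I (𝓘(ℝ, EB).prod 𝓘(ℝ, EF)) ∞ (fun x => (h b).choose (f x : G)) :=
      he.comp_contMDiff hf fun x => hs _
    exact fun x => (h1 x).snd

end FiberSmooth

end Bundle

end GroupBundle

end

open GroupBundle

/-! The trivialization is parallel transport. If every `g` lies on a unique global horizontal
section `P g`, then `(a, b) ↦ P a b` is a bijection from `G_x × B` to `G` with inverse `g ↦ (P g x,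
q g)`. It is multiplicative because a fibrewise product of horizontal sections is horizontal, by
compatibility of `𝓛` with composition, and horizontal sections are determined by one value.

Local existence is Frobenius' theorem. In charts `𝓛` is the graph of a lift operator `X`,
involutivity says that `X` is flat, and `exists_integral_sections` integrates `X` along rays. Smooth
dependence on parameters comes from the implicit function theorem in the Banach space of curves
`C(I, E)`.

Global existence is the main difficulty, since a flat connection with noncompact fibres need not be
complete; here the group structure gives completeness. Near the identity of `G_b₀`, horizontal
sections exist over one common neighbourhood of `b₀`. The points that they and their products reach
form an open, hence clopen, subgroup of each nearby fibre. Translating by one section through each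
component handles that component (`exists_isHorizontalOn_connectedComponent`). The neighbourhood may
depend on the component, but a lifted path stays in one component while its projection stays in a
trivializing set, so paths lift (`exists_lift_Iic`). With the leaf topology on `G`, `q` is a local
homeomorphism with path lifting, and simple connectedness lets the identity of `B` lift through any
point.

Smoothness of `P` near the identity section follows from a clopen argument in `B`; translation by a
horizontal section extends it to all of `G` (`contMDiff_transport`). -/

noncomputable section

/-! ### Calculus in spaces of continuous functions -/

section Superposition

variable {K : Type*} [TopologicalSpace K] [CompactSpace K]

/-- Pointwise application of a continuous family of continuous linear maps, the linear maps being
given through a normed space `A` of parameters. -/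
def ContinuousMap.applyCLM (K : Type*) [TopologicalSpace K] [CompactSpace K]
    {A E F : Type*} [NormedAddCommGroup A] [NormedSpace ℝ A] [NormedAddCommGroup E]
    [NormedSpace ℝ E] [NormedAddCommGroup F] [NormedSpace ℝ F] (ev : A →L[ℝ] E →L[ℝ] F) :
    C(K, A) →L[ℝ] C(K, E) →L[ℝ] C(K, F) :=
  LinearMap.mkContinuous₂
    (LinearMap.mk₂ ℝ (fun (a : C(K, A)) (u : C(K, E)) =>
        (⟨fun k => ev (a k) (u k), by fun_prop⟩ : C(K, F)))
      (fun _ _ _ => by ext; simp) (fun _ _ _ => by ext; simp)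
      (fun _ _ _ => by ext; simp) (fun _ _ _ => by ext; simp)) ‖ev‖
    (fun a u => by
      rw [ContinuousMap.norm_le _ (by positivity)]
      intro k
      refine (ev.le_opNorm₂ (a k) (u k)).trans ?_
      gcongr
      · exact a.norm_coe_le_norm k
      · exact u.norm_coe_le_norm k)

section

variable {A E F : Type*} [NormedAddCommGroup A] [NormedSpace ℝ A] [NormedAddCommGroup E]
  [NormedSpace ℝ E] [NormedAddCommGroup F] [NormedSpace ℝ F] (ev : A →L[ℝ] E →L[ℝ] F)

@[simp] theorem ContinuousMap.applyCLM_apply (a : C(K, A)) (u : C(K, E)) (k : K) :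
    ContinuousMap.applyCLM K ev a u k = ev (a k) (u k) := rfl

/-- The mean value inequality is applied pointwise in `k`. Its error is uniform in `k` because `v ↦
g' ∘ v` is continuous for the sup norm. -/
theorem ContinuousMap.hasFDerivAt_comp_left (g : C(E, F)) (g' : C(E, A))
    (h : ∀ x, HasFDerivAt g (ev (g' x)) x) (u : C(K, E)) :
    HasFDerivAt (fun v : C(K, E) => g.comp v) (ContinuousMap.applyCLM K ev (g'.comp u)) u := by
  rw [hasFDerivAt_iff_isLittleO_nhds_zero, Asymptotics.isLittleO_iff]
  intro c hc
  have hcont : ContinuousAt (fun v : C(K, E) => g'.comp v) u :=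
    (ContinuousMap.continuous_postcomp g').continuousAt
  obtain ⟨δ, hδ, hball⟩ := Metric.continuousAt_iff.1 hcont (c / (‖ev‖ + 1)) (by positivity)
  filter_upwards [Metric.ball_mem_nhds (0 : C(K, E)) hδ] with w hw
  rw [mem_ball_zero_iff] at hw
  rw [ContinuousMap.norm_le _ (by positivity)]
  intro k
  have hseg : ∀ x ∈ segment ℝ (u k) (u k + w k), ‖ev (g' x) - ev (g' (u k))‖ ≤ c := by
    intro x hx
    rw [segment_eq_image'] at hx
    obtain ⟨θ, ⟨h0, h1⟩, rfl⟩ := hx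
    have h2 := hball (x := u + θ • w) (by
      rw [dist_eq_norm, add_sub_cancel_left, norm_smul, Real.norm_of_nonneg h0]
      nlinarith [norm_nonneg w])
    rw [dist_eq_norm] at h2
    have h3 := (ContinuousMap.norm_coe_le_norm (g'.comp (u + θ • w) - g'.comp u) k).trans h2.le
    rw [← map_sub]
    refine (ev.le_opNorm _).trans ?_
    calc ‖ev‖ * _ ≤ (‖ev‖ + 1) * (c / (‖ev‖ + 1)) := by
          gcongr
          · linarith
          · simpa using h3
      _ = c := by field_simp
  have := (convex_segment (𝕜 := ℝ) (u k) (u k + w k)).norm_image_sub_le_of_norm_hasFDerivWithin_le'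
    (φ := ev (g' (u k))) (fun x _ => (h x).hasFDerivWithinAt) hseg (left_mem_segment ℝ _ _)
    (right_mem_segment ℝ _ _)
  simp only [add_sub_cancel_left] at this
  calc ‖g (u k + w k) - g (u k) - ev (g' (u k)) (w k)‖ ≤ c * ‖w k‖ := this
    _ ≤ c * ‖w‖ := by gcongr; exact w.norm_coe_le_norm k

end

universe u v

/-- The derivative is superposition with `fderiv ℝ g` followed by a bounded linear map, so induction
on `n` applies. The codomain changes from `F` to `E →L[ℝ] F`; the universe of `F` is taken above
that of `E` so that both live in the same one. -/
theorem ContinuousMap.contDiff_nat_comp_left (n : ℕ)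
    {E : Type u} [NormedAddCommGroup E] [NormedSpace ℝ E]
    {F : Type max u v} [NormedAddCommGroup F] [NormedSpace ℝ F] (g : C(E, F))
    (hg : ContDiff ℝ n g) :
    ContDiff ℝ n (fun v : C(K, E) => g.comp v) := by
  induction n generalizing F with
  | zero => exact contDiff_zero.2 (ContinuousMap.continuous_postcomp g)
  | succ n ih =>
    push_cast at hg
    have hd := (contDiff_succ_iff_fderiv.1 hg).2.2
    have hdiff : Differentiable ℝ g := hg.differentiable (by simp)
    let g' : C(E, E →L[ℝ] F) := ⟨fderiv ℝ g, hd.continuous⟩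
    have H := ContinuousMap.hasFDerivAt_comp_left (K := K) (.id ℝ (E →L[ℝ] F)) g g'
      fun x => (hdiff x).hasFDerivAt
    have e : fderiv ℝ (fun v : C(K, E) => g.comp v) =
        fun u => ContinuousMap.applyCLM K (.id ℝ (E →L[ℝ] F)) (g'.comp u) :=
      funext fun u => (H u).fderiv
    push_cast
    rw [contDiff_succ_iff_fderiv]
    refine ⟨fun u => (H u).differentiableAt, by simp, ?_⟩
    rw [e]
    exact (ContinuousMap.applyCLM K (.id ℝ (E →L[ℝ] F))).contDiff.comp (ih g' hd)

theorem ContinuousMap.contDiff_comp_left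
    {E : Type u} [NormedAddCommGroup E] [NormedSpace ℝ E]
    {F : Type max u v} [NormedAddCommGroup F] [NormedSpace ℝ F] (g : C(E, F))
    (hg : ContDiff ℝ ∞ g) :
    ContDiff ℝ ∞ (fun v : C(K, E) => g.comp v) :=
  contDiff_infty.2 fun n =>
    ContinuousMap.contDiff_nat_comp_left n g (hg.of_le (by exact_mod_cast le_top))

end Superposition

section Integral

open unitInterval

/-- The indefinite integral as an operator on continuous functions on the unit interval. -/
def unitInterval.integralCLM (E : Type*) [NormedAddCommGroup E] [NormedSpace ℝ E] :
    C(I, E) →L[ℝ] C(I, E) :=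
  LinearMap.mkContinuous
    { toFun := fun u => ⟨fun t => ∫ s in (0 : ℝ)..t, u (projIcc 0 1 zero_le_one s), by
        have : Continuous fun t : ℝ => ∫ s in (0 : ℝ)..t, u (projIcc 0 1 zero_le_one s) :=
          intervalIntegral.continuous_primitive
            (fun a b => (Continuous.intervalIntegrable (by fun_prop) a b)) 0
        exact this.comp continuous_subtype_val⟩
      map_add' := fun u v => by
        ext t
        exact intervalIntegral.integral_add
          (Continuous.intervalIntegrable (by fun_prop) _ _)
          (Continuous.intervalIntegrable (by fun_prop) _ _)
      map_smul' := fun c u => by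
        ext t
        exact intervalIntegral.integral_smul c _ }
    1 (fun u => by
      rw [ContinuousMap.norm_le _ (by positivity)]
      intro t
      refine (intervalIntegral.norm_integral_le_of_norm_le_const (C := ‖u‖)
        fun s _ => u.norm_coe_le_norm _).trans ?_
      rw [sub_zero, abs_of_nonneg t.2.1, mul_comm]
      exact mul_le_mul_of_nonneg_right t.2.2 (norm_nonneg _))

end Integral

/-! ### Smooth implicit functions near a point -/

section Implicit

variable {E₁ : Type*} [NormedAddCommGroup E₁] [NormedSpace ℝ E₁] [CompleteSpace E₁]
  {E₂ : Type*} [NormedAddCommGroup E₂] [NormedSpace ℝ E₂] [CompleteSpace E₂]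
  {F : Type*} [NormedAddCommGroup F] [NormedSpace ℝ F] [CompleteSpace F]

/-- `ContDiffAt ℝ ∞` at one point does not spread to a neighbourhood, which may shrink with the
order of differentiation. Invertibility of the partial derivative is an open condition, however, and
near each nearby `p` the function coincides, by uniqueness, with the implicit function based at `(p,
ψ p)`. -/
theorem ContDiff.eventually_contDiffAt_implicitFunction {f : E₁ × E₂ → F} (hf : ContDiff ℝ ∞ f)
    (u : E₁ × E₂) (hn : (∞ : WithTop ℕ∞) ≠ 0)
    (hinv : (fderiv ℝ f u ∘L .inr ℝ E₁ E₂).IsInvertible) :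
    ∀ᶠ p in 𝓝 u.1, ContDiffAt ℝ ∞ (hf.contDiffAt.implicitFunction hn hinv) p := by
  set ψ := hf.contDiffAt.implicitFunction hn hinv with hψ
  have hψu : ψ u.1 = u.2 := hf.contDiffAt.implicitFunction_apply_self hn hinv
  have hψ0 : ContDiffAt ℝ ∞ ψ u.1 := hf.contDiffAt.contDiffAt_implicitFunction hn hinv
  have h1 : ∀ᶠ p in 𝓝 u.1, ContinuousAt ψ p := by
    filter_upwards [(hψ0.of_le (m := 1) (by exact_mod_cast le_top)).eventually (by simp)] with p hp
    exact hp.continuousAt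
  have h2 : ∀ᶠ p in 𝓝 u.1, ∀ᶠ p' in 𝓝 p, f (p', ψ p') = f u :=
    (hf.contDiffAt.eventually_apply_implicitFunction hn hinv).eventually_nhds
  have h3 : ∀ᶠ p in 𝓝 u.1, (fderiv ℝ f (p, ψ p) ∘L .inr ℝ E₁ E₂).IsInvertible := by
    have hc : ContinuousAt (fun p => fderiv ℝ f (p, ψ p) ∘L .inr ℝ E₁ E₂) u.1 :=
      ContinuousAt.clm_comp (ContinuousAt.comp (g := fderiv ℝ f)
        (hf.continuous_fderiv (by simp)).continuousAt (continuousAt_id.prodMk hψ0.continuousAt))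
        continuousAt_const
    obtain ⟨e, he⟩ := hinv
    have hu : (u.1, ψ u.1) = u := by rw [hψu]
    refine hc.eventually ?_
    simp only [hu, ← he]
    exact e.nhds
  filter_upwards [h1, h2, h3] with p hp1 hp2 hp3
  have h4 := hf.contDiffAt.eventually_apply_eq_iff_implicitFunction (u := (p, ψ p)) hn hp3
  have h5 : Filter.Tendsto (fun p' => (p', ψ p')) (𝓝 p) (𝓝 (p, ψ p)) :=
    continuousAt_id.prodMk hp1
  refine (hf.contDiffAt.contDiffAt_implicitFunction (u := (p, ψ p)) hn hp3).congr_of_eventuallyEq ?_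
  filter_upwards [h5.eventually h4, hp2] with p' hp' hp2'
  exact (hp'.1 (hp2'.trans hp2.self_of_nhds.symm)).symm

end Implicit

/-! ### Frobenius' theorem in a vector space -/

section Radial

open unitInterval

variable {E : Type*} [NormedAddCommGroup E] [NormedSpace ℝ E]
  {V : Type*} [NormedAddCommGroup V] [NormedSpace ℝ V]

/-- The function `t ↦ X (u t) v` along a curve `u`, as a function of `((z, v), u)`. -/
def radialField (X : C(E, V →L[ℝ] E)) (p : (E × V) × C(I, E)) : C(I, E) :=
  ⟨fun t => X (p.2 t) p.1.2, by fun_prop⟩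

@[simp] theorem radialField_apply (X : C(E, V →L[ℝ] E)) (p : (E × V) × C(I, E)) (t : I) :
    radialField X p t = X (p.2 t) p.1.2 := rfl

theorem contDiff_radialField (X : C(E, V →L[ℝ] E)) (hX : ContDiff ℝ ∞ X) :
    ContDiff ℝ ∞ (radialField X) := by
  -- The dummy component `0` puts the codomain in the universe required by
  -- `ContinuousMap.contDiff_comp_left`.
  let g : C(E × V, E × V) := ⟨fun p => (X p.1 p.2, 0), by fun_prop⟩
  have hg : ContDiff ℝ ∞ g := ((hX.comp contDiff_fst).clm_apply contDiff_snd).prodMk contDiff_const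
  have h1 : ContDiff ℝ ∞ fun p : (E × V) × C(I, E) =>
      (ContinuousLinearMap.inl ℝ E V).compLeftContinuous ℝ I p.2 +
        (ContinuousLinearMap.inr ℝ E V).compLeftContinuous ℝ I
          (ContinuousLinearMap.const ℝ I p.1.2) := by fun_prop
  have h2 := ((ContinuousLinearMap.fst ℝ E V).compLeftContinuous ℝ I).contDiff.comp
    ((ContinuousMap.contDiff_comp_left (K := I) g hg).comp h1)
  convert h2 using 1
  ext p t
  simp [g]

theorem fderiv_radialField_apply (X : C(E, V →L[ℝ] E)) (hX : ContDiff ℝ ∞ X)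
    (p δ : (E × V) × C(I, E)) (t : I) :
    fderiv ℝ (radialField X) p δ t =
      fderiv ℝ X (p.2 t) (δ.2 t) p.1.2 + X (p.2 t) δ.1.2 := by
  have h1 : HasFDerivAt (radialField X) (fderiv ℝ (radialField X) p) p :=
    ((contDiff_radialField X hX).differentiable (by simp) p).hasFDerivAt
  have h2 := ((ContinuousMap.evalCLM ℝ t : C(I, E) →L[ℝ] E).hasFDerivAt.comp p h1)
  have h3 : HasFDerivAt X (fderiv ℝ X (p.2 t)) (p.2 t) :=
    (hX.differentiable (by simp) _).hasFDerivAt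
  have h4 : HasFDerivAt (fun q : (E × V) × C(I, E) => q.2 t)
      ((ContinuousMap.evalCLM ℝ t : C(I, E) →L[ℝ] E).comp (ContinuousLinearMap.snd ℝ _ _)) p :=
    ((ContinuousMap.evalCLM ℝ t : C(I, E) →L[ℝ] E).comp
      (ContinuousLinearMap.snd ℝ (E × V) C(I, E))).hasFDerivAt
  have h5 : HasFDerivAt (fun q : (E × V) × C(I, E) => q.1.2)
      ((ContinuousLinearMap.snd ℝ E V).comp (ContinuousLinearMap.fst ℝ _ _)) p :=
    ((ContinuousLinearMap.snd ℝ E V).comp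
      (ContinuousLinearMap.fst ℝ (E × V) C(I, E))).hasFDerivAt
  have h6 := (h3.comp p h4).clm_apply h5
  have := congrArg (fun L : (E × V) × C(I, E) →L[ℝ] E => L δ) (h2.unique h6)
  simpa [add_comm] using this

/-- The integral form of `u' = X(u) v`, `u 0 = z`, is solved by the implicit function theorem. For
`v = 0` the integral term vanishes, so the partial derivative in `u` at the constant curve is the
identity. Small `v` replaces short time, so all curves live on the whole unit interval. -/
theorem exists_radial_solution [CompleteSpace E] [CompleteSpace V] (X : C(E, V →L[ℝ] E))
    (hX : ContDiff ℝ ∞ X) (z₀ : E) :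
    ∃ y : E × V → C(I, E), (∀ᶠ p in 𝓝 (z₀, (0 : V)), ContDiffAt ℝ ∞ y p) ∧
      y (z₀, 0) = .const I z₀ ∧
      ∀ᶠ p in 𝓝 (z₀, (0 : V)), y p =
        ContinuousLinearMap.const ℝ I p.1 + integralCLM E (radialField X (p, y p)) := by
  let Φ : (E × V) × C(I, E) → C(I, E) := fun q =>
    q.2 - ContinuousLinearMap.const ℝ I q.1.1 - integralCLM E (radialField X q)
  have hΦ : ContDiff ℝ ∞ Φ := by
    have h1 := (integralCLM E).contDiff (n := ∞) |>.comp (contDiff_radialField X hX)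
    have h2 : ContDiff ℝ ∞ fun q : (E × V) × C(I, E) =>
      q.2 - ContinuousLinearMap.const ℝ I q.1.1 := by fun_prop
    exact h2.sub h1
  let u₀ : (E × V) × C(I, E) := ((z₀, 0), .const I z₀)
  have h0 : ∀ (z : E) (u : C(I, E)), radialField X ((z, 0), u) = 0 := fun z u => by ext; simp
  have hpart : fderiv ℝ Φ u₀ ∘L .inr ℝ (E × V) C(I, E) = .id ℝ _ := by
    have h1 : HasFDerivAt Φ (fderiv ℝ Φ u₀) u₀ := (hΦ.differentiable (by simp) _).hasFDerivAt
    have h2 := h1.comp (.const I z₀ : C(I, E)) (hasFDerivAt_prodMk_right (𝕜 := ℝ) (z₀, (0 : V)) _)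
    have h3 : HasFDerivAt (Φ ∘ fun u => ((z₀, (0 : V)), u)) (.id ℝ C(I, E))
        (.const I z₀ : C(I, E)) := by
      have : (Φ ∘ fun u => ((z₀, (0 : V)), u)) =
          fun u => u - ContinuousLinearMap.const ℝ I z₀ := by
        ext u t
        simp [Φ, h0]
      rw [this]
      exact (hasFDerivAt_id _).sub_const _
    exact h2.unique h3
  have hinv : (fderiv ℝ Φ u₀ ∘L .inr ℝ (E × V) C(I, E)).IsInvertible := by
    rw [hpart]; exact ⟨.refl ℝ _, rfl⟩
  have hn : (∞ : WithTop ℕ∞) ≠ 0 := by simp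
  refine ⟨hΦ.contDiffAt.implicitFunction hn hinv,
    hΦ.eventually_contDiffAt_implicitFunction u₀ hn hinv,
    hΦ.contDiffAt.implicitFunction_apply_self hn hinv, ?_⟩
  filter_upwards [hΦ.contDiffAt.eventually_apply_implicitFunction hn hinv] with p hp
  have h1 : Φ u₀ = 0 := by
    ext t; simp [Φ, u₀, h0]
  rw [h1] at hp
  have : hΦ.contDiffAt.implicitFunction hn hinv p - ContinuousLinearMap.const ℝ I p.1 -
    integralCLM E (radialField X (p, hΦ.contDiffAt.implicitFunction hn hinv p)) = 0 := hp
  rw [sub_sub, sub_eq_zero] at this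
  exact this

theorem hasDerivAt_integral_projIcc [CompleteSpace E] (u : C(I, E)) (t : ℝ) :
    HasDerivAt (fun t : ℝ => ∫ s in (0 : ℝ)..t, u (projIcc 0 1 zero_le_one s))
      (u (projIcc 0 1 zero_le_one t)) t :=
  intervalIntegral.integral_hasDerivAt_right (Continuous.intervalIntegrable (by fun_prop) _ _)
    (Continuous.stronglyMeasurableAtFilter (by fun_prop) _ _)
    (Continuous.continuousAt (by fun_prop))

theorem exists_norm_le_of_continuous {K A : Type*} [TopologicalSpace K] [CompactSpace K]
    [SeminormedAddCommGroup A] {f : K → A} (hf : Continuous f) : ∃ C : ℝ, ∀ t, ‖f t‖ ≤ C :=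
  ⟨_, fun t => (⟨f, hf⟩ : C(K, A)).norm_coe_le_norm t⟩

/-- Frobenius' theorem in coordinates: a flat linear lift `X` of constant vector fields has a smooth
family of integral sections. -/
theorem exists_integral_sections [CompleteSpace E] [CompleteSpace V] (X : C(E, V →L[ℝ] E))
    (hX : ContDiff ℝ ∞ X) {z₀ : E}
    (hflat : ∀ᶠ z in 𝓝 z₀, ∀ v w, fderiv ℝ X z (X z v) w = fderiv ℝ X z (X z w) v) :
    ∃ s : E × V → E, s (z₀, 0) = z₀ ∧
      ∀ᶠ p in 𝓝 (z₀, (0 : V)), ContDiffAt ℝ ∞ s p ∧ s (p.1, 0) = p.1 ∧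
        HasFDerivAt (fun v => s (p.1, v)) (X (s p)) p.2 := by
  obtain ⟨y, hy, hy0, hyeq⟩ := exists_radial_solution X hX z₀
  obtain ⟨δ, hδ, hball⟩ := Metric.eventually_nhds_iff_ball.1 hflat
  -- The section at displacement `v` is the endpoint of the radial solution in direction `v`.
  refine ⟨fun p => y p 1, by simp [hy0], ?_⟩
  have hnear : ∀ᶠ p in 𝓝 (z₀, (0 : V)), ∀ t : I, y p t ∈ Metric.ball z₀ δ := by
    have := hy.self_of_nhds.continuousAt.eventually (Metric.ball_mem_nhds _ hδ)
    filter_upwards [this] with p hp t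
    rw [hy0] at hp
    exact (ContinuousMap.dist_apply_le_dist (f := y p) (g := .const I z₀) t).trans_lt hp
  have hzero : ∀ᶠ p in 𝓝 (z₀, (0 : V)), y (p.1, 0) 1 = p.1 := by
    have hc : Filter.Tendsto (fun p : E × V => (p.1, (0 : V))) (𝓝 (z₀, 0)) (𝓝 (z₀, 0)) := by
      have : Continuous fun p : E × V => (p.1, (0 : V)) := by fun_prop
      simpa using this.tendsto (z₀, (0 : V))
    filter_upwards [hc.eventually hyeq] with p hp
    have h0 : radialField X ((p.1, 0), y (p.1, 0)) = 0 := by ext; simp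
    rw [hp, h0]
    simp
  filter_upwards [hnear, hzero, hy, hyeq.eventually_nhds] with p hpn hp0 hpc hpe
  have hpd : DifferentiableAt ℝ y p := hpc.differentiableAt (by simp)
  refine ⟨(ContinuousMap.evalCLM ℝ (1 : I) : C(I, E) →L[ℝ] E).contDiff.contDiffAt.comp _ hpc,
    hp0, ?_⟩
  have hd : HasFDerivAt (fun v => y (p.1, v) 1)
      ((ContinuousMap.evalCLM ℝ (1 : I) : C(I, E) →L[ℝ] E) ∘L
        (fderiv ℝ y p ∘L .inr ℝ E V)) p.2 :=
    (ContinuousMap.evalCLM ℝ (1 : I) : C(I, E) →L[ℝ] E).hasFDerivAt.comp p.2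
      (hpd.hasFDerivAt.comp p.2 (hasFDerivAt_prodMk_right (𝕜 := ℝ) p.1 p.2))
  convert hd using 1
  ext w
  set Y : C(I, E) := fderiv ℝ y p (0, w) with hY
  -- the linearized integral equation
  have hYeq : Y = integralCLM E (fderiv ℝ (radialField X) (p, y p) ((0, w), Y)) := by
    have h1 := ((contDiff_radialField X hX).differentiable (by simp) (p, y p)).hasFDerivAt
    have h2 := h1.comp p ((hasFDerivAt_id p).prodMk hpd.hasFDerivAt)
    have h3 := ((ContinuousLinearMap.const ℝ I ∘L ContinuousLinearMap.fst ℝ E V).hasFDerivAt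
      (x := p)).add ((integralCLM E).hasFDerivAt.comp p h2)
    have h4 := h3.congr_of_eventuallyEq hpe
    have h5 := congrArg (fun L : E × V →L[ℝ] C(I, E) => L (0, w)) (hpd.hasFDerivAt.unique h4)
    simpa [hY] using h5
  let pr : ℝ → I := projIcc 0 1 zero_le_one
  -- `a` and `b` extend the solution and its derivative in direction `w` to the real line, so that
  -- two-sided derivatives exist at the endpoints too.
  let a : ℝ → E := fun t => p.1 + ∫ s in (0 : ℝ)..t, radialField X (p, y p) (pr s)
  let b : ℝ → E := fun t => ∫ s in (0 : ℝ)..t,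
    fderiv ℝ (radialField X) (p, y p) ((0, w), Y) (pr s)
  have ha : ∀ t : I, a t = y p t := fun t => by
    conv_rhs => rw [hpe.self_of_nhds]
    rfl
  have hb : ∀ t : I, b t = Y t := fun t => by
    conv_rhs => rw [hYeq]
    rfl
  have hpr : ∀ t ∈ Icc (0 : ℝ) 1, ((pr t : I) : ℝ) = t := fun t ht => by
    simp only [pr, projIcc_of_mem zero_le_one ht]
  have hda : ∀ t, HasDerivAt a (X (y p (pr t)) p.2) t := fun t =>
    (hasDerivAt_integral_projIcc (radialField X (p, y p)) t).const_add p.1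
  have hdb : ∀ t, HasDerivAt b (fderiv ℝ X (y p (pr t)) (Y (pr t)) p.2 + X (y p (pr t)) w) t := by
    intro t
    have := hasDerivAt_integral_projIcc (fderiv ℝ (radialField X) (p, y p) ((0, w), Y)) t
    rw [fderiv_radialField_apply X hX] at this
    exact this
  -- The claim is `Z 1 = 0`. Differentiating the second term yields `t • DX(X v) w`, which flatness
  -- turns into `t • DX(X w) v`. Thus `Z' = DX(Z) v` is linear homogeneous with `Z 0 = 0`.
  let Z : ℝ → E := fun t => b t - t • X (a t) w
  have hdZ : ∀ t ∈ Icc (0 : ℝ) 1, HasDerivAt Z (fderiv ℝ X (y p (pr t)) (Z t) p.2) t := by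
    intro t ht
    have hat : a t = y p (pr t) := by rw [← ha, hpr t ht]
    have hbt : b t = Y (pr t) := by rw [← hb, hpr t ht]
    have h1 : HasFDerivAt X (fderiv ℝ X (a t)) (a t) :=
      (hX.differentiable (by simp) _).hasFDerivAt
    have h2 := (h1.comp_hasDerivAt t (hda t)).clm_apply (hasDerivAt_const t w)
    have h3 := (hdb t).sub ((hasDerivAt_id t).smul h2)
    refine h3.congr_deriv ?_
    have hf := hball (y p (pr t)) (hpn _) w p.2
    simp only [Z, hat, hbt, id_eq, Function.comp_apply, one_smul, map_sub, map_smul, map_zero,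
      add_zero, sub_apply, smul_apply, hf]
    abel
  obtain ⟨C, hC⟩ : ∃ C : ℝ, ∀ t : I, ‖fderiv ℝ X (y p t)‖ ≤ C := by
    have hcont : Continuous fun t : I => fderiv ℝ X (y p t) :=
      (hX.continuous_fderiv (by simp)).comp (y p).continuous
    exact exists_norm_le_of_continuous (A := E →L[ℝ] V →L[ℝ] E) hcont
  have hZ : ∀ t ∈ Icc (0 : ℝ) 1, Z t = 0 := by
    refine eq_zero_of_abs_deriv_le_mul_abs_self_of_eq_zero_right (K := C * ‖p.2‖)
      (f' := fun t => fderiv ℝ X (y p (pr t)) (Z t) p.2)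
      (fun t ht => (hdZ t ht).continuousAt.continuousWithinAt)
      (fun t ht => (hdZ t (Ico_subset_Icc_self ht)).hasDerivWithinAt) (by simp [Z, b]) ?_
    intro t _
    calc _ ≤ ‖fderiv ℝ X (y p (pr t))‖ * ‖Z t‖ * ‖p.2‖ := ContinuousLinearMap.le_opNorm₂ _ _ _
      _ ≤ C * ‖Z t‖ * ‖p.2‖ := by gcongr; exact hC _
      _ = _ := by ring
  have h1 := hZ 1 (by simp)
  have h2 := ha 1
  have h3 := hb 1
  simp only [Icc.coe_one] at h2 h3
  simp only [Z, h2, h3, one_smul, sub_eq_zero] at h1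
  simp [h1.symm, hY]

end Radial

/-! ### Horizontal lifts in charts and their flatness -/

section VectorSpace

variable {E : Type*} [NormedAddCommGroup E] [NormedSpace ℝ E]
  {V : Type*} [NormedAddCommGroup V] [NormedSpace ℝ V]

/-- Superposition on `C(I, E)` needs a globally smooth field, whereas a lift operator is defined
only in a chart; a bump function extends its germ. -/
theorem ContDiffOn.exists_contDiff_eventuallyEq [FiniteDimensional ℝ E] {f : E → V} {O : Set E}
    (hf : ContDiffOn ℝ ∞ f O) (hO : IsOpen O) {z : E} (hz : z ∈ O) :
    ∃ g : E → V, ContDiff ℝ ∞ g ∧ g =ᶠ[𝓝 z] f := by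
  obtain ⟨ε, hε, hball⟩ := Metric.nhds_basis_closedBall.mem_iff.1 (hO.mem_nhds hz)
  let χ : ContDiffBump z := ⟨ε / 2, ε, by positivity, by linarith⟩
  refine ⟨fun y => χ y • f y, contDiff_iff_contDiffAt.2 fun y => ?_, ?_⟩
  · by_cases hy : y ∈ O
    · exact χ.contDiff.contDiffAt.smul (hf.contDiffAt (hO.mem_nhds hy))
    · have : (fun y => χ y • f y) =ᶠ[𝓝 y] fun _ => 0 := by
        have h1 : y ∈ (Metric.closedBall z ε)ᶜ := fun h => hy (hball h)
        filter_upwards [Metric.isClosed_closedBall.isOpen_compl.mem_nhds h1] with w hw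
        rw [χ.zero_of_le_dist (not_le.1 fun h => hw (Metric.mem_closedBall.2 h)).le, zero_smul]
      exact contDiffAt_const.congr_of_eventuallyEq this
  · filter_upwards [χ.eventuallyEq_one] with w hw
    simp [hw]

/-- The bracket of two lifts of constant vector fields through `Q` is tangent to the fibres of
`Q`. -/
theorem fderiv_bracket_lift_eq_zero {Q : E → V} {X : E → V →L[ℝ] E} {z : E}
    (hQ : ContDiffAt ℝ 2 Q z) (hX : DifferentiableAt ℝ X z)
    (h : ∀ᶠ y in 𝓝 z, ∀ u, fderiv ℝ Q y (X y u) = u) (u w : V) :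
    fderiv ℝ Q z (fderiv ℝ X z (X z u) w - fderiv ℝ X z (X z w) u) = 0 := by
  have hQ' : DifferentiableAt ℝ (fderiv ℝ Q) z :=
    (hQ.fderiv_right (m := 1) (by norm_num)).differentiableAt (by simp)
  -- Differentiate the identity `DQ (X u) = u` in direction `a`. Symmetry of the second derivative
  -- of `Q` then cancels the two terms of the bracket.
  have key : ∀ a u, fderiv ℝ Q z (fderiv ℝ X z a u) = - fderiv ℝ (fderiv ℝ Q) z a (X z u) := by
    intro a u
    have h1 := hQ'.hasFDerivAt.clm_apply (hX.hasFDerivAt.clm_apply (hasFDerivAt_const u z))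
    have h2 : HasFDerivAt (fun y => fderiv ℝ Q y (X y u)) (0 : E →L[ℝ] V) z :=
      (hasFDerivAt_const u z).congr_of_eventuallyEq (h.mono fun y hy => hy u)
    have h3 := congrArg (fun L : E →L[ℝ] V => L a) (h1.unique h2)
    simp at h3
    exact eq_neg_of_add_eq_zero_left h3
  have hs : IsSymmSndFDerivAt ℝ Q z := hQ.isSymmSndFDerivAt (by simp)
  rw [map_sub, key, key, hs (X z u) (X z w), sub_self]

end VectorSpace

section Manifold

variable {E : Type*} [NormedAddCommGroup E] [NormedSpace ℝ E]
  {M : Type*} [TopologicalSpace M] [ChartedSpace E M] [IsManifold 𝓘(ℝ, E) ∞ M]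
  {W : Type*} [NormedAddCommGroup W] [NormedSpace ℝ W]

open GroupBundle

theorem GroupBundle.SmoothFieldOn.contMDiffOn_mfderiv_apply {X : Π p : M, TangentSpace 𝓘(ℝ, E) p}
    {N : Set M} (hX : SmoothFieldOn 𝓘(ℝ, E) X N) (hN : IsOpen N) {f : M → W}
    (hf : ContMDiffOn 𝓘(ℝ, E) 𝓘(ℝ, W) ∞ f N) :
    ContMDiffOn 𝓘(ℝ, E) 𝓘(ℝ, W) ∞ (fun p => (mfderiv 𝓘(ℝ, E) 𝓘(ℝ, W) f p (X p) : W)) N := by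
  have h1 := hf.contMDiffOn_tangentMapWithin (m := ∞) (by simp) hN.uniqueMDiffOn
  have h2 := h1.comp (t := TotalSpace.proj ⁻¹' N) hX (fun p hp => hp)
  have h3 := (contMDiff_snd_tangentBundle_modelSpace (n := ∞) W 𝓘(ℝ, W)).comp_contMDiffOn h2
  refine h3.congr fun p hp => ?_
  change _ = (mfderivWithin 𝓘(ℝ, E) 𝓘(ℝ, W) f N p (X p) : W)
  rw [mfderivWithin_of_isOpen hN hp]

end Manifold

section Lift

open GroupBundle

variable {EB : Type*} [NormedAddCommGroup EB] [NormedSpace ℝ EB]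
  {EG : Type*} [NormedAddCommGroup EG] [NormedSpace ℝ EG]
  {B : Type*} [TopologicalSpace B] [ChartedSpace EB B] [IsManifold 𝓘(ℝ, EB) ∞ B]
  {G : Type*} [TopologicalSpace G] [ChartedSpace EG G] [IsManifold 𝓘(ℝ, EG) ∞ G]
  {q : G → B} {𝓛 : Π g : G, Submodule ℝ (TangentSpace 𝓘(ℝ, EG) g)}

theorem sum_proj_smulRight_apply {r : ℕ} {W : Type*} [NormedAddCommGroup W] [NormedSpace ℝ W]
    (y : Fin r → W) (c : Fin r → ℝ) :
    (∑ i, (ContinuousLinearMap.proj i : (Fin r → ℝ) →L[ℝ] ℝ).smulRight (y i)) c =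
      ∑ i, c i • y i := by
  simp

theorem GroupBundle.IsFlatConnection.bijOn_mfderiv_chart_comp
    (h : IsFlatConnection (EB := EB) q 𝓛) (hq : ContMDiff 𝓘(ℝ, EG) 𝓘(ℝ, EB) ∞ q) {b : B} {g : G}
    (hg : q g ∈ (extChartAt 𝓘(ℝ, EB) b).source) :
    BijOn (mfderiv 𝓘(ℝ, EG) 𝓘(ℝ, EB) (extChartAt 𝓘(ℝ, EB) b ∘ q) g) (𝓛 g) univ := by
  have hinv := isInvertible_mfderiv_extChartAt (I := 𝓘(ℝ, EB)) hg
  rw [mfderiv_comp g (mdifferentiableAt_extChartAt (by rwa [← extChartAt_source 𝓘(ℝ, EB)]))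
    (hq.mdifferentiable (by simp) g)]
  exact (bijOn_univ.2 hinv.bijective).comp (h.bijOn g)

/-- The operator `EB → EG` of horizontal lift, along the image of a coordinate chart. -/
theorem GroupBundle.IsFlatConnection.exists_lift (h : IsFlatConnection (EB := EB) q 𝓛)
    (hq : ContMDiff 𝓘(ℝ, EG) 𝓘(ℝ, EB) ∞ q) (g₀ : G) :
    ∃ (N : Set G) (X : G → EB →L[ℝ] EG), IsOpen N ∧ g₀ ∈ N ∧
      N ⊆ (extChartAt 𝓘(ℝ, EG) g₀).source ∧ N ⊆ q ⁻¹' (extChartAt 𝓘(ℝ, EB) (q g₀)).source ∧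
      ContMDiffOn 𝓘(ℝ, EG) 𝓘(ℝ, EB →L[ℝ] EG) ∞ X N ∧
      ∀ g ∈ N, ∀ ξ ∈ 𝓛 g,
        (mfderiv 𝓘(ℝ, EG) 𝓘(ℝ, EG) (extChartAt 𝓘(ℝ, EG) g₀) g ξ : EG) =
          X g (mfderiv 𝓘(ℝ, EG) 𝓘(ℝ, EB) (extChartAt 𝓘(ℝ, EB) (q g₀) ∘ q) g ξ) := by
  obtain ⟨U, r, Xf, hU, hg₀, hXf, hspan⟩ := h.foliation.subbundle g₀
  set κ := extChartAt 𝓘(ℝ, EG) g₀ with hκ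
  set φ := extChartAt 𝓘(ℝ, EB) (q g₀) with hφ
  let N := U ∩ (κ.source ∩ q ⁻¹' φ.source)
  have hN : IsOpen N := hU.inter ((isOpen_extChartAt_source g₀).inter
    ((isOpen_extChartAt_source (q g₀)).preimage hq.continuous))
  have hφN : ContMDiffOn 𝓘(ℝ, EG) 𝓘(ℝ, EB) ∞ (φ ∘ q) N := by
    have h1 : ContMDiffOn 𝓘(ℝ, EB) 𝓘(ℝ, EB) ∞ φ φ.source := by
      rw [hφ, extChartAt_source]; exact contMDiffOn_extChartAt
    exact h1.comp hq.contMDiffOn fun g hg => hg.2.2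
  have hκN : ContMDiffOn 𝓘(ℝ, EG) 𝓘(ℝ, EG) ∞ κ N := by
    have h1 : ContMDiffOn 𝓘(ℝ, EG) 𝓘(ℝ, EG) ∞ κ κ.source := by
      rw [hκ, extChartAt_source]; exact contMDiffOn_extChartAt
    exact h1.mono fun g hg => hg.2.1
  have hXN : ∀ i, SmoothFieldOn 𝓘(ℝ, EG) (Xf i) N := fun i => (hXf i).mono inter_subset_left
  let pr : Fin r → (Fin r → ℝ) →L[ℝ] ℝ := fun i => ContinuousLinearMap.proj i
  -- A local frame of `𝓛` is read in the chart of `G` by `L` and, after projection, in the chart of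
  -- `B` by `D`. Since `𝓛` projects isomorphically, `D` is invertible and the lift is `L ∘ D⁻¹`.
  let L : G → (Fin r → ℝ) →L[ℝ] EG := fun g =>
    ∑ i, (pr i).smulRight (mfderiv 𝓘(ℝ, EG) 𝓘(ℝ, EG) κ g (Xf i g) : EG)
  let D : G → (Fin r → ℝ) →L[ℝ] EB := fun g =>
    ∑ i, (pr i).smulRight (mfderiv 𝓘(ℝ, EG) 𝓘(ℝ, EB) (φ ∘ q) g (Xf i g) : EB)
  have hL : ContMDiffOn 𝓘(ℝ, EG) 𝓘(ℝ, (Fin r → ℝ) →L[ℝ] EG) ∞ L N := by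
    refine contMDiffOn_finsetSum fun i _ => ?_
    exact (ContinuousLinearMap.smulRightL ℝ (Fin r → ℝ) EG (pr i)).contMDiff.comp_contMDiffOn
      ((hXN i).contMDiffOn_mfderiv_apply hN hκN)
  have hD : ContMDiffOn 𝓘(ℝ, EG) 𝓘(ℝ, (Fin r → ℝ) →L[ℝ] EB) ∞ D N := by
    refine contMDiffOn_finsetSum fun i _ => ?_
    exact (ContinuousLinearMap.smulRightL ℝ (Fin r → ℝ) EB (pr i)).contMDiff.comp_contMDiffOn
      ((hXN i).contMDiffOn_mfderiv_apply hN hφN)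
  have hLc : ∀ g (c : Fin r → ℝ), L g c = mfderiv 𝓘(ℝ, EG) 𝓘(ℝ, EG) κ g (∑ i, c i • Xf i g) :=
    fun g c => (sum_proj_smulRight_apply _ c).trans
      ((map_sum (mfderiv 𝓘(ℝ, EG) 𝓘(ℝ, EG) κ g) _ _).trans
        (Finset.sum_congr rfl fun i _ => map_smul _ _ _)).symm
  have hDc : ∀ g (c : Fin r → ℝ),
      D g c = mfderiv 𝓘(ℝ, EG) 𝓘(ℝ, EB) (φ ∘ q) g (∑ i, c i • Xf i g) :=
    fun g c => (sum_proj_smulRight_apply _ c).trans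
      ((map_sum (mfderiv 𝓘(ℝ, EG) 𝓘(ℝ, EB) (φ ∘ q) g) _ _).trans
        (Finset.sum_congr rfl fun i _ => map_smul _ _ _)).symm
  have hDinv : ∀ g ∈ N, Function.Bijective (D g) := by
    intro g hg
    have hb := h.bijOn_mfderiv_chart_comp hq (b := q g₀) hg.2.2
    obtain ⟨hli, hsp⟩ := hspan g hg.1
    have hmem : ∀ c : Fin r → ℝ, ∑ i, c i • Xf i g ∈ 𝓛 g := fun c => by
      rw [← hsp]; exact (Submodule.mem_span_range_iff_exists_fun ℝ).2 ⟨c, rfl⟩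
    constructor
    · intro c c' hcc
      rw [hDc, hDc] at hcc
      have h1 := hb.injOn (hmem c) (hmem c') hcc
      exact hli.fintypeLinearCombination_injective (by
        simpa [Fintype.linearCombination_apply] using h1)
    · intro u
      obtain ⟨ξ, hξ, hξv⟩ := hb.surjOn (mem_univ u)
      rw [SetLike.mem_coe, ← hsp] at hξ
      obtain ⟨c, rfl⟩ := (Submodule.mem_span_range_iff_exists_fun ℝ).1 hξ
      exact ⟨c, by rw [hDc]; exact hξv⟩
  refine ⟨N, fun g => L g ∘L (D g).inverse, hN, ⟨hg₀, mem_extChartAt_source g₀,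
    mem_extChartAt_source (q g₀)⟩, fun g hg => hg.2.1, fun g hg => hg.2.2, ?_, ?_⟩
  · refine hL.clm_comp fun g hg => ?_
    let e : (Fin r → ℝ) ≃L[ℝ] EB := (LinearEquiv.ofBijective (D g : (Fin r → ℝ) →ₗ[ℝ] EB)
      (hDinv g hg)).toContinuousLinearEquiv
    have he : (e : (Fin r → ℝ) →L[ℝ] EB) = D g := by ext; rfl
    have h1 := contDiffAt_map_inverse (n := ∞) e
    rw [he] at h1
    exact h1.contMDiffAt.comp_contMDiffWithinAt g (hD g hg)
  · intro g hg ξ hξ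
    rw [← (hspan g hg.1).2] at hξ
    obtain ⟨c, rfl⟩ := (Submodule.mem_span_range_iff_exists_fun ℝ).1 hξ
    rw [← hLc, ← hDc]
    let e : (Fin r → ℝ) ≃L[ℝ] EB := (LinearEquiv.ofBijective (D g : (Fin r → ℝ) →ₗ[ℝ] EB)
      (hDinv g hg)).toContinuousLinearEquiv
    have he : (e : (Fin r → ℝ) →L[ℝ] EB) = D g := by ext; rfl
    have hc : (D g).inverse (D g c) = c := by rw [← he]; simp
    exact congrArg (L g) hc.symm

end Lift

section Lift

open GroupBundle VectorField

variable {EB : Type*} [NormedAddCommGroup EB] [NormedSpace ℝ EB]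
  {EG : Type*} [NormedAddCommGroup EG] [NormedSpace ℝ EG] [FiniteDimensional ℝ EG]
  {B : Type*} [TopologicalSpace B] [ChartedSpace EB B] [IsManifold 𝓘(ℝ, EB) ∞ B]
  {G : Type*} [TopologicalSpace G] [ChartedSpace EG G] [IsManifold 𝓘(ℝ, EG) ∞ G]
  {q : G → B} {𝓛 : Π g : G, Submodule ℝ (TangentSpace 𝓘(ℝ, EG) g)}

/-- In coordinates, a flat connection is the operator of horizontal lift `X`, which is flat. -/
theorem GroupBundle.IsFlatConnection.exists_flat_lift (h : IsFlatConnection (EB := EB) q 𝓛)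
    (hq : ContMDiff 𝓘(ℝ, EG) 𝓘(ℝ, EB) ∞ q) (g₀ : G) :
    ∃ X : C(EG, EB →L[ℝ] EG), ContDiff ℝ ∞ X ∧
      (∀ᶠ z in 𝓝 (extChartAt 𝓘(ℝ, EG) g₀ g₀), ∀ v w,
        fderiv ℝ X z (X z v) w = fderiv ℝ X z (X z w) v) ∧
      (∀ᶠ z in 𝓝 (extChartAt 𝓘(ℝ, EG) g₀ g₀), DifferentiableAt ℝ
        (fun z => extChartAt 𝓘(ℝ, EB) (q g₀) (q ((extChartAt 𝓘(ℝ, EG) g₀).symm z))) z ∧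
        ∀ u, fderiv ℝ (fun z => extChartAt 𝓘(ℝ, EB) (q g₀) (q ((extChartAt 𝓘(ℝ, EG) g₀).symm z))) z
          (X z u) = u) ∧
      (∀ᶠ g in 𝓝 g₀, ∀ u, (mfderiv 𝓘(ℝ, EG) 𝓘(ℝ, EG) (extChartAt 𝓘(ℝ, EG) g₀) g).inverse
        (X (extChartAt 𝓘(ℝ, EG) g₀ g) u) ∈ 𝓛 g) ∧
      ∀ᶠ g in 𝓝 g₀, ∀ ξ ∈ 𝓛 g,
        (mfderiv 𝓘(ℝ, EG) 𝓘(ℝ, EG) (extChartAt 𝓘(ℝ, EG) g₀) g ξ : EG) =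
          X (extChartAt 𝓘(ℝ, EG) g₀ g)
            (mfderiv 𝓘(ℝ, EG) 𝓘(ℝ, EB) (extChartAt 𝓘(ℝ, EB) (q g₀) ∘ q) g ξ) := by
  obtain ⟨N, X₀, hN, hg₀, hNκ, hNφ, hX₀, hlift⟩ := h.exists_lift hq g₀
  have : IsManifold 𝓘(ℝ, EG) (minSmoothness ℝ 2) G := by
    simp only [minSmoothness_of_isRCLikeNormedField]; infer_instance
  have h2 : (2 : WithTop ℕ∞) ≤ ∞ := WithTop.coe_le_coe.2 le_top
  set κ := extChartAt 𝓘(ℝ, EG) g₀ with hκ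
  set φ := extChartAt 𝓘(ℝ, EB) (q g₀) with hφ
  let O : Set EG := κ.target ∩ κ.symm ⁻¹' N
  have hO : IsOpen O := (continuousOn_extChartAt_symm g₀).isOpen_inter_preimage
    (isOpen_extChartAt_target g₀) hN
  have hz₀ : κ g₀ ∈ O := ⟨mem_extChartAt_target g₀, by
    rw [mem_preimage, extChartAt_to_inv]; exact hg₀⟩
  have hκs : ContMDiffOn 𝓘(ℝ, EG) 𝓘(ℝ, EG) ∞ κ.symm O :=
    (contMDiffOn_extChartAt_symm g₀).mono inter_subset_left
  have hX₀O : ContDiffOn ℝ ∞ (X₀ ∘ κ.symm) O :=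
    contMDiffOn_iff_contDiffOn.1 (hX₀.comp hκs fun z hz => hz.2)
  obtain ⟨X, hX, hXX₀⟩ := hX₀O.exists_contDiff_eventuallyEq hO hz₀
  obtain ⟨O', hO'sub, hO', hz₀'⟩ := mem_nhds_iff.1 (Filter.inter_mem (hO.mem_nhds hz₀) hXX₀)
  let N' := κ.source ∩ κ ⁻¹' O'
  have hN' : IsOpen N' := (continuousOn_extChartAt g₀).isOpen_inter_preimage
    (isOpen_extChartAt_source g₀) hO'
  have hgN' : g₀ ∈ N' := ⟨mem_extChartAt_source g₀, hz₀'⟩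
  have hN'N : N' ⊆ N := fun g hg => by
    have := (hO'sub hg.2).1.2
    rwa [mem_preimage, κ.left_inv hg.1] at this
  let dκ : G → EG →L[ℝ] EG := fun g => mfderiv 𝓘(ℝ, EG) 𝓘(ℝ, EG) κ g
  let dφ : G → EG →L[ℝ] EB := fun g => mfderiv 𝓘(ℝ, EG) 𝓘(ℝ, EB) (φ ∘ q) g
  let 𝓓 : G → Submodule ℝ EG := fun g => 𝓛 g
  have hlift' : ∀ g ∈ N', ∀ ξ ∈ 𝓓 g, dκ g ξ = X (κ g) (dφ g ξ) := by
    intro g hg ξ hξ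
    have h1 : X (κ g) = X₀ g := by
      have : X (κ g) = (X₀ ∘ κ.symm) (κ g) := (hO'sub hg.2).2
      rw [this, Function.comp_apply, κ.left_inv hg.1]
    rw [h1]
    exact hlift g (hN'N hg) ξ hξ
  have hbij : ∀ g ∈ N', BijOn (dφ g) (𝓓 g) univ := fun g hg =>
    h.bijOn_mfderiv_chart_comp hq (hNφ (hN'N hg))
  -- the map `q` in coordinates
  let Q : EG → EB := (φ ∘ q) ∘ κ.symm
  have hφN : ContMDiffOn 𝓘(ℝ, EG) 𝓘(ℝ, EB) ∞ (φ ∘ q) N := by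
    have h1 : ContMDiffOn 𝓘(ℝ, EB) 𝓘(ℝ, EB) ∞ φ φ.source := by
      rw [hφ, extChartAt_source]; exact contMDiffOn_extChartAt
    exact h1.comp hq.contMDiffOn hNφ
  have hQ : ContDiffOn ℝ ∞ Q O := contMDiffOn_iff_contDiffOn.1 (hφN.comp hκs fun z hz => hz.2)
  have hκat : ∀ g ∈ N', ContMDiffAt 𝓘(ℝ, EG) 𝓘(ℝ, EG) ∞ κ g := fun g hg =>
    contMDiffAt_extChartAt' (by rw [← extChartAt_source 𝓘(ℝ, EG)]; exact hg.1)
  have hinv : ∀ g ∈ N', (dκ g).IsInvertible := fun g hg =>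
    isInvertible_mfderiv_extChartAt hg.1
  have hdQ : ∀ g ∈ N', ∀ ξ, dφ g ξ = fderiv ℝ Q (κ g) (dκ g ξ) := by
    intro g hg ξ
    have h1 : φ ∘ q =ᶠ[𝓝 g] Q ∘ κ := by
      filter_upwards [hN'.mem_nhds hg] with g' hg'
      simp only [Q, Function.comp_apply, κ.left_inv hg'.1]
    have h2 : DifferentiableAt ℝ Q (κ g) :=
      (hQ.contDiffAt (hO.mem_nhds (hO'sub hg.2).1)).differentiableAt (by simp)
    simp only [dφ, dκ]
    rw [h1.mfderiv_eq, mfderiv_comp g h2.mdifferentiableAt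
      ((hκat g hg).mdifferentiableAt (by simp)), mfderiv_eq_fderiv]
    rfl
  have hXmem : ∀ g ∈ N', ∀ u : EB, (dκ g).inverse (X (κ g) u) ∈ 𝓓 g := by
    intro g hg u
    obtain ⟨ξ, hξ, rfl⟩ := (hbij g hg).surjOn (mem_univ u)
    rw [← hlift' g hg ξ hξ]
    rwa [(hinv g hg).inverse_apply_eq.2 rfl]
  have hQX : ∀ y ∈ O', ∀ u, fderiv ℝ Q y (X y u) = u := by
    intro y hy u
    have hyt := (hO'sub hy).1.1
    have hg : κ.symm y ∈ N' := ⟨κ.map_target hyt, by rwa [mem_preimage, κ.right_inv hyt]⟩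
    obtain ⟨ξ, hξ, rfl⟩ := (hbij _ hg).surjOn (mem_univ u)
    have h2 := hdQ _ hg ξ
    rw [hlift' _ hg ξ hξ, κ.right_inv hyt] at h2
    exact h2.symm
  refine ⟨⟨X, hX.continuous⟩, hX, ?_, Filter.mem_of_superset (hO'.mem_nhds hz₀') fun y hy =>
    ⟨(hQ.contDiffAt (hO.mem_nhds (hO'sub hy).1)).differentiableAt (by simp), hQX y hy⟩,
    Filter.mem_of_superset (hN'.mem_nhds hgN') hXmem,
    Filter.mem_of_superset (hN'.mem_nhds hgN') hlift'⟩
  filter_upwards [hO'.mem_nhds hz₀'] with z hz u w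
  change fderiv ℝ X z (X z u) w = fderiv ℝ X z (X z w) u
  have hzt := (hO'sub hz).1.1
  let g := κ.symm z
  have hgz : κ g = z := κ.right_inv hzt
  have hg : g ∈ N' := ⟨κ.map_target hzt, by rwa [mem_preimage, hgz]⟩
  let Xc : EB → Π z : EG, TangentSpace 𝓘(ℝ, EG) z := fun u z => X z u
  have hXc : ∀ u z, ContMDiffAt 𝓘(ℝ, EG) 𝓘(ℝ, EG).tangent ∞
      (fun z => (⟨z, Xc u z⟩ : TangentBundle 𝓘(ℝ, EG) EG)) z := fun u z =>
    contMDiffAt_vectorSpace_iff_contDiffAt.2 ((hX.clm_apply contDiff_const).contDiffAt)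
  have hV : ∀ u, SmoothFieldOn 𝓘(ℝ, EG) (mpullback 𝓘(ℝ, EG) 𝓘(ℝ, EG) κ (Xc u)) N' :=
    fun u g hg => (ContMDiffAt.mpullback_vectorField_preimage (n := ∞) (hXc u (κ g)) (hκat g hg)
      (hinv g hg) (by simp)).contMDiffWithinAt
  -- The lifts of constant fields, pulled back to `G`, are sections of `𝓛`; hence so is their
  -- bracket.
  have hbr := h.foliation.involutive N' _ _ hN' (hV u) (hV w) (fun g hg => hXmem g hg u)
    (fun g hg => hXmem g hg w) g hg
  rw [← mpullback_mlieBracket (n := ∞) ((hXc u _).mdifferentiableAt (by simp))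
    ((hXc w _).mdifferentiableAt (by simp)) (hκat g hg)
    (by simp only [minSmoothness_of_isRCLikeNormedField]; exact h2),
    ← mlieBracketWithin_univ, mlieBracketWithin_eq_lieBracketWithin, lieBracketWithin_univ] at hbr
  set η : EG := fderiv ℝ X z (X z u) w - fderiv ℝ X z (X z w) u with hη
  have hlb : lieBracket ℝ (fun z => X z u) (fun z => X z w) z = η := by
    have hd : ∀ u a, fderiv ℝ (fun z => X z u) z a = fderiv ℝ X z a u := by
      intro u a
      have h1 := (hX.differentiable (by simp) z).hasFDerivAt.clm_apply (hasFDerivAt_const u z)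
      simp [h1.fderiv]
    rw [lieBracket, hd, hd]
  have hmem : (dκ g).inverse η ∈ 𝓓 g := by
    rw [← hlb, ← hgz]
    exact hbr
  have h3 : dκ g ((dκ g).inverse η) = η := ((hinv g hg).inverse_apply_eq.1 rfl).symm
  have h4 : fderiv ℝ Q z η = 0 := fderiv_bracket_lift_eq_zero
    ((hQ.contDiffAt (hO.mem_nhds (hO'sub hz).1)).of_le h2)
    (hX.differentiable (by simp) z) (Filter.mem_of_superset (hO'.mem_nhds hz) hQX) u w
  -- The bracket `η` is both horizontal and vertical. A horizontal vector is the lift of its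
  -- projection, so `η = 0`.
  have h5 := hlift' g hg _ hmem
  rw [hdQ g hg, h3, hgz, h4, map_zero] at h5
  exact sub_eq_zero.1 h5

end Lift

/-! ### Horizontal sections: local existence and uniqueness -/

section Uniqueness

variable {E : Type*} [NormedAddCommGroup E] [NormedSpace ℝ E]
  {V : Type*} [NormedAddCommGroup V] [NormedSpace ℝ V]

/-- Along the segment from `v₀` to `v`, both maps solve the ordinary differential equation of the
field `x ↦ X x (v - v₀)`, which is Lipschitz near `s v₀`. -/
theorem eventuallyEq_of_hasFDerivAt_lift {X : E → V →L[ℝ] E} {s s' : V → E} {v₀ : V}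
    (hX : ContDiffAt ℝ 1 X (s v₀)) (hs : ∀ᶠ v in 𝓝 v₀, HasFDerivAt s (X (s v)) v)
    (hs' : ∀ᶠ v in 𝓝 v₀, HasFDerivAt s' (X (s' v)) v) (h : s v₀ = s' v₀) :
    s =ᶠ[𝓝 v₀] s' := by
  obtain ⟨K, O, hO, hK⟩ := hX.exists_lipschitzOnWith
  have hO' := hO
  rw [h] at hO'
  have h1 := hs.self_of_nhds.continuousAt.eventually hO
  have h2 := hs'.self_of_nhds.continuousAt.eventually hO'
  obtain ⟨ε, hε, hball⟩ := Metric.eventually_nhds_iff_ball.1 ((hs.and hs').and (h1.and h2))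
  filter_upwards [Metric.ball_mem_nhds v₀ hε] with v hv
  let c : ℝ → V := fun t => v₀ + t • (v - v₀)
  have hc : ∀ t ∈ Icc (0 : ℝ) 1, c t ∈ Metric.ball v₀ ε := by
    intro t ht
    rw [mem_ball_iff_norm] at hv ⊢
    simp only [c, add_sub_cancel_left, norm_smul, Real.norm_of_nonneg ht.1]
    exact (mul_le_of_le_one_left (norm_nonneg _) ht.2).trans_lt hv
  have hdc : ∀ t, HasDerivAt c (v - v₀) t := fun t =>
    (((hasDerivAt_id t).smul_const (v - v₀)).const_add v₀).congr_deriv (one_smul _ _)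
  have hd : ∀ t ∈ Icc (0 : ℝ) 1, HasDerivAt (s ∘ c) (X (s (c t)) (v - v₀)) t := fun t ht =>
    (hball _ (hc t ht)).1.1.comp_hasDerivAt t (hdc t)
  have hd' : ∀ t ∈ Icc (0 : ℝ) 1, HasDerivAt (s' ∘ c) (X (s' (c t)) (v - v₀)) t := fun t ht =>
    (hball _ (hc t ht)).1.2.comp_hasDerivAt t (hdc t)
  have hlip : LipschitzOnWith (‖v - v₀‖₊ * K) (fun x => X x (v - v₀)) O :=
    ((ContinuousLinearMap.apply ℝ E (v - v₀)).lipschitz.comp_lipschitzOnWith hK).weaken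
      (mul_le_mul_left (by
        refine (ContinuousLinearMap.opNorm_le_bound _ (norm_nonneg _) fun f => ?_ :
          ‖ContinuousLinearMap.apply ℝ E (v - v₀)‖ ≤ ‖v - v₀‖)
        rw [mul_comm]
        exact f.le_opNorm _) K)
  have key := ODE_solution_unique_of_mem_Icc_right (v := fun _ x => X x (v - v₀)) (s := fun _ => O)
    (f := s ∘ c) (g := s' ∘ c) (a := 0) (b := 1) (fun _ _ => hlip)
    (fun t ht => (hd t ht).continuousAt.continuousWithinAt)
    (fun t ht => (hd t (Ico_subset_Icc_self ht)).hasDerivWithinAt)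
    (fun t ht => (hball _ (hc t (Ico_subset_Icc_self ht))).2.1)
    (fun t ht => (hd' t ht).continuousAt.continuousWithinAt)
    (fun t ht => (hd' t (Ico_subset_Icc_self ht)).hasDerivWithinAt)
    (fun t ht => (hball _ (hc t (Ico_subset_Icc_self ht))).2.2) (by simpa [c] using h)
    (right_mem_Icc.2 zero_le_one)
  simpa [c] using key

end Uniqueness

section Horizontal

open GroupBundle

variable {EB : Type*} [NormedAddCommGroup EB] [NormedSpace ℝ EB]
  {EG : Type*} [NormedAddCommGroup EG] [NormedSpace ℝ EG]
  {B : Type*} [TopologicalSpace B] [ChartedSpace EB B]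
  {G : Type*} [TopologicalSpace G] [ChartedSpace EG G]

/-- `s` is a smooth section of `q` over the open set `U` which is tangent to `𝓛`. -/
structure GroupBundle.IsHorizontalOn (q : G → B)
    (𝓛 : Π g : G, Submodule ℝ (TangentSpace 𝓘(ℝ, EG) g)) (s : B → G) (U : Set B) : Prop where
  isOpen : IsOpen U
  smooth : ContMDiffOn 𝓘(ℝ, EB) 𝓘(ℝ, EG) ∞ s U
  apply_eq : ∀ b ∈ U, q (s b) = b
  mem : ∀ b ∈ U, ∀ w : TangentSpace 𝓘(ℝ, EB) b, mfderiv 𝓘(ℝ, EB) 𝓘(ℝ, EG) s b w ∈ 𝓛 (s b)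

variable {q : G → B} {𝓛 : Π g : G, Submodule ℝ (TangentSpace 𝓘(ℝ, EG) g)} {s s' : B → G}
  {U U' : Set B}

theorem GroupBundle.mem_of_eq_of_mem {g g' : G} (h : g = g') {v : EG}
    (hv : v ∈ (show Submodule ℝ EG from 𝓛 g)) : v ∈ (show Submodule ℝ EG from 𝓛 g') := h ▸ hv

theorem GroupBundle.IsHorizontalOn.mono (h : IsHorizontalOn (EB := EB) q 𝓛 s U) (hU' : IsOpen U')
    (hsub : U' ⊆ U) : IsHorizontalOn (EB := EB) q 𝓛 s U' :=
  ⟨hU', h.smooth.mono hsub, fun b hb => h.apply_eq b (hsub hb), fun b hb => h.mem b (hsub hb)⟩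

theorem GroupBundle.IsHorizontalOn.congr (h : IsHorizontalOn (EB := EB) q 𝓛 s U)
    (heq : EqOn s' s U) : IsHorizontalOn (EB := EB) q 𝓛 s' U := by
  refine ⟨h.isOpen, h.smooth.congr heq, fun b hb => by rw [heq hb, h.apply_eq b hb],
    fun b hb w => ?_⟩
  have h1 : s' =ᶠ[𝓝 b] s := heq.eventuallyEq_of_mem (h.isOpen.mem_nhds hb)
  have h2 := h.mem b hb w
  rw [← h1.mfderiv_eq] at h2
  exact mem_of_eq_of_mem (EG := EG) (heq hb).symm h2

theorem GroupBundle.IsHorizontalOn.contMDiffAt (h : IsHorizontalOn (EB := EB) q 𝓛 s U) {b : B}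
    (hb : b ∈ U) : ContMDiffAt 𝓘(ℝ, EB) 𝓘(ℝ, EG) ∞ s b :=
  h.smooth.contMDiffAt (h.isOpen.mem_nhds hb)

variable [IsManifold 𝓘(ℝ, EB) ∞ B] [IsManifold 𝓘(ℝ, EG) ∞ G]

/-- The derivative of a section projects to the identity. Being tangent to `𝓛`, it must therefore be
the lift operator itself. -/
theorem GroupBundle.IsHorizontalOn.eventually_hasFDerivAt (h : IsHorizontalOn (EB := EB) q 𝓛 s U)
    (hq : ContMDiff 𝓘(ℝ, EG) 𝓘(ℝ, EB) ∞ q) {b : B} (hb : b ∈ U) {g₀ : G} (hg₀ : s b = g₀)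
    {X : EG → EB →L[ℝ] EG}
    (hX : ∀ᶠ g in 𝓝 g₀, ∀ ξ ∈ 𝓛 g,
        (mfderiv 𝓘(ℝ, EG) 𝓘(ℝ, EG) (extChartAt 𝓘(ℝ, EG) g₀) g ξ : EG) =
          X (extChartAt 𝓘(ℝ, EG) g₀ g)
            (mfderiv 𝓘(ℝ, EG) 𝓘(ℝ, EB) (extChartAt 𝓘(ℝ, EB) (q g₀) ∘ q) g ξ)) :
    ∀ᶠ v in 𝓝 (extChartAt 𝓘(ℝ, EB) (q g₀) b),
      HasFDerivAt (fun v => extChartAt 𝓘(ℝ, EG) g₀ (s ((extChartAt 𝓘(ℝ, EB) (q g₀)).symm v)))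
        (X (extChartAt 𝓘(ℝ, EG) g₀ (s ((extChartAt 𝓘(ℝ, EB) (q g₀)).symm v)))) v := by
  have hqb : q g₀ = b := by rw [← hg₀, h.apply_eq b hb]
  rw [hqb] at hX ⊢
  set κ := extChartAt 𝓘(ℝ, EG) g₀ with hκ
  set φ := extChartAt 𝓘(ℝ, EB) b with hφ
  have hs : Filter.Tendsto s (𝓝 b) (𝓝 g₀) := by
    have := (h.contMDiffAt hb).continuousAt
    rwa [ContinuousAt, hg₀] at this
  have hφs : Filter.Tendsto φ.symm (𝓝 (φ b)) (𝓝 b) := by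
    have := continuousAt_extChartAt_symm (I := 𝓘(ℝ, EB)) b
    rwa [ContinuousAt, extChartAt_to_inv] at this
  filter_upwards [hφs.eventually (h.isOpen.mem_nhds hb), hφs.eventually (hs.eventually hX),
    hφs.eventually (hs.eventually (extChartAt_source_mem_nhds (I := 𝓘(ℝ, EG)) g₀)),
    extChartAt_target_mem_nhds (I := 𝓘(ℝ, EB)) b] with v hvU hvX hvκ hvt
  have hφd : ContMDiffAt 𝓘(ℝ, EB) 𝓘(ℝ, EB) ∞ φ.symm v :=
    (contMDiffOn_extChartAt_symm b).contMDiffAt (extChartAt_target_mem_nhds' hvt)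
  have hTd : MDifferentiableAt 𝓘(ℝ, EB) 𝓘(ℝ, EG) (s ∘ φ.symm) v :=
    ((h.contMDiffAt hvU).comp v hφd).mdifferentiableAt (by simp)
  have hκd : MDifferentiableAt 𝓘(ℝ, EG) 𝓘(ℝ, EG) κ ((s ∘ φ.symm) v) :=
    mdifferentiableAt_extChartAt (by rw [← extChartAt_source 𝓘(ℝ, EG)]; exact hvκ)
  have hqd : MDifferentiableAt 𝓘(ℝ, EG) 𝓘(ℝ, EB) (φ ∘ q) ((s ∘ φ.symm) v) := by
    have h1 : q (s (φ.symm v)) = φ.symm v := h.apply_eq _ hvU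
    refine (mdifferentiableAt_extChartAt (x := b) ?_).comp _ (hq.mdifferentiable (by simp) _)
    rw [← extChartAt_source 𝓘(ℝ, EB), Function.comp_apply, h1]
    exact φ.map_target hvt
  let dT : EB →L[ℝ] EG := mfderiv 𝓘(ℝ, EB) 𝓘(ℝ, EG) (s ∘ φ.symm) v
  let dκ : EG →L[ℝ] EG := mfderiv 𝓘(ℝ, EG) 𝓘(ℝ, EG) κ ((s ∘ φ.symm) v)
  let dφ : EG →L[ℝ] EB := mfderiv 𝓘(ℝ, EG) 𝓘(ℝ, EB) (φ ∘ q) ((s ∘ φ.symm) v)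
  have h1 : HasFDerivAt (κ ∘ s ∘ φ.symm) (dκ ∘L dT) v :=
    hasMFDerivAt_iff_hasFDerivAt.1 (hκd.hasMFDerivAt.comp v hTd.hasMFDerivAt)
  have h2 : HasFDerivAt ((φ ∘ q) ∘ s ∘ φ.symm) (dφ ∘L dT) v :=
    hasMFDerivAt_iff_hasFDerivAt.1 (hqd.hasMFDerivAt.comp v hTd.hasMFDerivAt)
  have h3 : HasFDerivAt ((φ ∘ q) ∘ s ∘ φ.symm) (.id ℝ EB) v := by
    refine (hasFDerivAt_id v).congr_of_eventuallyEq ?_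
    filter_upwards [extChartAt_target_mem_nhds' hvt, hφd.continuousAt.eventually
      (h.isOpen.mem_nhds hvU)] with y hy hyU
    simp only [Function.comp_apply, h.apply_eq _ hyU, id, φ.right_inv hy]
  have h4 := h2.unique h3
  refine h1.congr_fderiv ?_
  ext u
  have hmem : mfderiv 𝓘(ℝ, EB) 𝓘(ℝ, EG) (s ∘ φ.symm) v u ∈ 𝓛 (s (φ.symm v)) := by
    rw [mfderiv_comp v ((h.contMDiffAt hvU).mdifferentiableAt (by simp))
      (hφd.mdifferentiableAt (by simp))]
    exact h.mem _ hvU _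
  refine (hvX _ hmem).trans ?_
  exact congrArg (X (κ (s (φ.symm v)))) (congrArg (fun L : EB →L[ℝ] EB => L u) h4)

end Horizontal

section Horizontal

open GroupBundle

variable {EB : Type*} [NormedAddCommGroup EB] [NormedSpace ℝ EB]
  {EG : Type*} [NormedAddCommGroup EG] [NormedSpace ℝ EG] [FiniteDimensional ℝ EG]
  {B : Type*} [TopologicalSpace B] [ChartedSpace EB B] [IsManifold 𝓘(ℝ, EB) ∞ B]
  {G : Type*} [TopologicalSpace G] [ChartedSpace EG G] [IsManifold 𝓘(ℝ, EG) ∞ G]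
  {q : G → B} {𝓛 : Π g : G, Submodule ℝ (TangentSpace 𝓘(ℝ, EG) g)} {s s' : B → G}
  {U U' : Set B}

/-- Horizontal sections are locally determined by their value at a point. -/
theorem GroupBundle.IsHorizontalOn.eventuallyEq (h𝓛 : IsFlatConnection (EB := EB) q 𝓛)
    (hq : ContMDiff 𝓘(ℝ, EG) 𝓘(ℝ, EB) ∞ q) (h : IsHorizontalOn (EB := EB) q 𝓛 s U)
    (h' : IsHorizontalOn (EB := EB) q 𝓛 s' U') {b : B} (hb : b ∈ U) (hb' : b ∈ U')
    (heq : s b = s' b) : s =ᶠ[𝓝 b] s' := by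
  obtain ⟨X, hX, -, -, -, hlift⟩ := h𝓛.exists_flat_lift hq (s b)
  have hqb : q (s b) = b := h.apply_eq b hb
  have h1 := h.eventually_hasFDerivAt hq hb rfl hlift
  have h2 := h'.eventually_hasFDerivAt hq hb' heq.symm hlift
  rw [hqb] at h1 h2
  have h3 := eventuallyEq_of_hasFDerivAt_lift (hX.contDiffAt.of_le (by exact_mod_cast le_top)) h1 h2
    (by simp only [extChartAt_to_inv, heq])
  have h4 : Filter.Tendsto (extChartAt 𝓘(ℝ, EB) b) (𝓝 b) (𝓝 (extChartAt 𝓘(ℝ, EB) b b)) :=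
    continuousAt_extChartAt b
  have hs : Filter.Tendsto s (𝓝 b) (𝓝 (s b)) := (h.contMDiffAt hb).continuousAt
  have hs' : Filter.Tendsto s' (𝓝 b) (𝓝 (s b)) := by
    rw [heq]; exact (h'.contMDiffAt hb').continuousAt
  have hκ := extChartAt_source_mem_nhds (I := 𝓘(ℝ, EG)) (s b)
  filter_upwards [h4.eventually h3, hs.eventually hκ, hs'.eventually hκ,
    extChartAt_source_mem_nhds (I := 𝓘(ℝ, EB)) b] with y hy hys hys' hyb
  simp only [(extChartAt 𝓘(ℝ, EB) b).left_inv hyb] at hy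
  exact (extChartAt 𝓘(ℝ, EG) (s b)).injOn hys hys' hy

/-- Horizontal sections which agree at a point of a connected open set agree on it. -/
theorem GroupBundle.IsHorizontalOn.eqOn [T2Space G] (h𝓛 : IsFlatConnection (EB := EB) q 𝓛)
    (hq : ContMDiff 𝓘(ℝ, EG) 𝓘(ℝ, EB) ∞ q) (h : IsHorizontalOn (EB := EB) q 𝓛 s U)
    (h' : IsHorizontalOn (EB := EB) q 𝓛 s' U) (hU : IsPreconnected U) {b : B} (hb : b ∈ U)
    (heq : s b = s' b) : EqOn s s' U := by
  let V := U ∩ {y | s =ᶠ[𝓝 y] s'}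
  have hV : IsOpen V := h.isOpen.inter isOpen_setOfPred_eventually_nhds
  -- Since `G` is Hausdorff, disagreement is open, so the open set `V` of local agreement is also
  -- closed in `U`.
  have hV' : IsOpen (U ∩ {y | s y ≠ s' y}) := by
    rw [isOpen_iff_mem_nhds]
    rintro y ⟨hy, hne⟩
    have h1 := (h.contMDiffAt hy).continuousAt
    have h2 := (h'.contMDiffAt hy).continuousAt
    filter_upwards [h.isOpen.mem_nhds hy, h1.ne_iff_eventually_ne h2 |>.1 hne] with z hz hz'
    exact ⟨hz, hz'⟩
  have hsub : U ⊆ V := by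
    refine hU.subset_of_closure_inter_subset hV ⟨b, hb, hb, h.eventuallyEq h𝓛 hq h' hb hb heq⟩ ?_
    rintro y ⟨hyV, hyU⟩
    refine ⟨hyU, h.eventuallyEq h𝓛 hq h' hyU hyU ?_⟩
    by_contra hne
    obtain ⟨z, ⟨-, hz⟩, -, hz'⟩ := mem_closure_iff.1 hyV _ hV' ⟨hyU, hne⟩
    exact hz hz'.self_of_nhds
  exact fun y hy => (hsub hy).2.self_of_nhds

/-- Through the points near `g₀` there is a smooth family of horizontal sections. -/
theorem GroupBundle.IsFlatConnection.exists_isHorizontalOn [CompleteSpace EB]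
    (h𝓛 : IsFlatConnection (EB := EB) q 𝓛)
    (hq : ContMDiff 𝓘(ℝ, EG) 𝓘(ℝ, EB) ∞ q) (g₀ : G) :
    ∃ (W : Set G) (U : Set B) (Ψ : G → B → G), IsOpen W ∧ g₀ ∈ W ∧ IsOpen U ∧ q g₀ ∈ U ∧
      ContMDiffOn (𝓘(ℝ, EG).prod 𝓘(ℝ, EB)) 𝓘(ℝ, EG) ∞ (fun p : G × B => Ψ p.1 p.2) (W ×ˢ U) ∧
      ∀ g ∈ W, q g ∈ U ∧ IsHorizontalOn (EB := EB) q 𝓛 (Ψ g) U ∧ Ψ g (q g) = g := by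
  obtain ⟨X, hX, hflat, hQ, hmem, -⟩ := h𝓛.exists_flat_lift hq g₀
  obtain ⟨S, hS0, hS⟩ := exists_integral_sections X hX hflat
  set κ := extChartAt 𝓘(ℝ, EG) g₀ with hκ
  set φ := extChartAt 𝓘(ℝ, EB) (q g₀) with hφ
  let Q : EG → EB := fun z => φ (q (κ.symm z))
  have hκs : Filter.Tendsto κ.symm (𝓝 (κ g₀)) (𝓝 g₀) := by
    have := continuousAt_extChartAt_symm (I := 𝓘(ℝ, EG)) g₀
    rwa [ContinuousAt, extChartAt_to_inv] at this
  have hnear : ∀ᶠ z in 𝓝 (κ g₀), (DifferentiableAt ℝ Q z ∧ ∀ u, fderiv ℝ Q z (X z u) = u) ∧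
      z ∈ κ.target ∧ q (κ.symm z) ∈ φ.source ∧
      ∀ u, (mfderiv 𝓘(ℝ, EG) 𝓘(ℝ, EG) κ (κ.symm z)).inverse (X z u) ∈ 𝓛 (κ.symm z) := by
    filter_upwards [hQ, extChartAt_target_mem_nhds (I := 𝓘(ℝ, EG)) g₀, hκs.eventually hmem,
      hκs.eventually (hq.continuous.continuousAt.eventually
        (extChartAt_source_mem_nhds (I := 𝓘(ℝ, EB)) (q g₀)))] with z h1 h2 h3 h4
    refine ⟨h1, h2, h4, ?_⟩
    rwa [κ.right_inv h2] at h3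
  have hSc : Filter.Tendsto S (𝓝 (κ g₀, 0)) (𝓝 (κ g₀)) := by
    have := hS.self_of_nhds.1.continuousAt
    rwa [ContinuousAt, hS0] at this
  obtain ⟨ε, hε, hball⟩ := Metric.eventually_nhds_iff_ball.1 (hS.and (hSc.eventually hnear))
  have hball' : ∀ z ∈ Metric.ball (κ g₀) ε, ∀ v ∈ Metric.ball (0 : EB) ε,
      (ContDiffAt ℝ ∞ S (z, v) ∧ S (z, 0) = z ∧
        HasFDerivAt (fun v => S (z, v)) (X (S (z, v))) v) ∧
      (DifferentiableAt ℝ Q (S (z, v)) ∧ ∀ u, fderiv ℝ Q (S (z, v)) (X (S (z, v)) u) = u) ∧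
      S (z, v) ∈ κ.target ∧ q (κ.symm (S (z, v))) ∈ φ.source ∧
      ∀ u, (mfderiv 𝓘(ℝ, EG) 𝓘(ℝ, EG) κ (κ.symm (S (z, v)))).inverse (X (S (z, v)) u) ∈
        𝓛 (κ.symm (S (z, v))) := fun z hz v hv =>
    hball (z, v) (by rw [← ball_prod_same]; exact ⟨hz, hv⟩)
  -- Radius `ε / 2` keeps the displacement between any two points of `U` below `ε`.
  let U : Set B := φ.source ∩ φ ⁻¹' Metric.ball (φ (q g₀)) (ε / 2)
  have hU : IsOpen U := (continuousOn_extChartAt _).isOpen_inter_preimage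
    (isOpen_extChartAt_source _) Metric.isOpen_ball
  let W : Set G := (κ.source ∩ κ ⁻¹' Metric.ball (κ g₀) ε) ∩ q ⁻¹' U
  have hW : IsOpen W := ((continuousOn_extChartAt _).isOpen_inter_preimage
    (isOpen_extChartAt_source _) Metric.isOpen_ball).inter (hU.preimage hq.continuous)
  have hqU : q g₀ ∈ U := ⟨mem_extChartAt_source _, Metric.mem_ball_self (by positivity)⟩
  let Ψ : G → B → G := fun g b => κ.symm (S (κ g, φ b - φ (q g)))
  have hdiff : ∀ g ∈ W, ∀ b ∈ U, φ b - φ (q g) ∈ Metric.ball (0 : EB) ε := by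
    intro g hg b hb
    rw [mem_ball_zero_iff, ← dist_eq_norm]
    have h1 : dist (φ b) (φ (q g₀)) < ε / 2 := hb.2
    have h2 : dist (φ (q g)) (φ (q g₀)) < ε / 2 := hg.2.2
    linarith [dist_triangle_right (φ b) (φ (q g)) (φ (q g₀))]
  have hφat : ∀ b ∈ U, ContMDiffAt 𝓘(ℝ, EB) 𝓘(ℝ, EB) ∞ φ b := fun b hb =>
    contMDiffAt_extChartAt' (by rw [← extChartAt_source 𝓘(ℝ, EB)]; exact hb.1)
  have hκat : ∀ g ∈ W, ContMDiffAt 𝓘(ℝ, EG) 𝓘(ℝ, EG) ∞ κ g := fun g hg =>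
    contMDiffAt_extChartAt' (by rw [← extChartAt_source 𝓘(ℝ, EG)]; exact hg.1.1)
  have hΨ : ContMDiffOn (𝓘(ℝ, EG).prod 𝓘(ℝ, EB)) 𝓘(ℝ, EG) ∞
      (fun p : G × B => Ψ p.1 p.2) (W ×ˢ U) := by
    rintro ⟨g, b⟩ ⟨hg, hb⟩
    have hp := hball' (κ g) hg.1.2 _ (hdiff g hg b hb)
    have h1 : ContMDiffAt 𝓘(ℝ, EG) 𝓘(ℝ, EG) ∞ κ.symm (S (κ g, φ b - φ (q g))) :=
      (contMDiffOn_extChartAt_symm g₀).contMDiffAt (extChartAt_target_mem_nhds' hp.2.2.1)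
    have h2 : ContMDiffAt (𝓘(ℝ, EG).prod 𝓘(ℝ, EB)) 𝓘(ℝ, EG) ∞ (fun p : G × B => κ p.1) (g, b) :=
      ContMDiffAt.comp (g := κ) (g, b) (hκat g hg) contMDiffAt_fst
    have h3 : ContMDiffAt (𝓘(ℝ, EG).prod 𝓘(ℝ, EB)) 𝓘(ℝ, EB) ∞ (fun p : G × B => φ p.2) (g, b) :=
      ContMDiffAt.comp (g := φ) (g, b) (hφat b hb) contMDiffAt_snd
    have h4 : ContMDiffAt (𝓘(ℝ, EG).prod 𝓘(ℝ, EB)) 𝓘(ℝ, EB) ∞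
        (fun p : G × B => φ (q p.1)) (g, b) :=
      ContMDiffAt.comp (g := φ) (g, b) (hφat (q g) hg.2)
        (hq.contMDiffAt.comp (g, b) contMDiffAt_fst)
    have h5 := h2.prodMk_space (h3.sub h4)
    exact (h1.comp (g, b)
      (ContMDiffAt.comp (g := S) (g, b) hp.1.1.contMDiffAt h5)).contMDiffWithinAt
  refine ⟨W, U, Ψ, hW, ⟨⟨mem_extChartAt_source _, Metric.mem_ball_self hε⟩, hqU⟩, hU, hqU, hΨ,
    fun g hg => ⟨hg.2, ⟨hU, ?_, ?_, ?_⟩, ?_⟩⟩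
  · exact hΨ.comp (contMDiff_const.prodMk contMDiff_id).contMDiffOn fun b hb => ⟨hg, hb⟩
  · intro b hb
    have hv := hdiff g hg b hb
    have hp := hball' (κ g) hg.1.2 _ hv
    -- The projection of the integral section has derivative the identity, so `R` is constant on the
    -- ball; comparison with `v = 0` shows that `Ψ g` is a section of `q`.
    let R : EB → EB := fun v => Q (S (κ g, v)) - v
    have hR : ∀ v ∈ Metric.ball (0 : EB) ε, HasFDerivAt R (0 : EB →L[ℝ] EB) v := by
      intro v hv
      obtain ⟨⟨-, -, h1⟩, ⟨h2, h3⟩, -⟩ := hball' (κ g) hg.1.2 v hv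
      refine ((h2.hasFDerivAt.comp v h1).sub (hasFDerivAt_id v)).congr_fderiv ?_
      ext u
      simp [h3]
    have h1 := (convex_ball (0 : EB) ε).is_const_of_fderivWithin_eq_zero (𝕜 := ℝ) (f := R)
      (fun v hv => (hR v hv).differentiableAt.differentiableWithinAt)
      (fun v hv => by rw [fderivWithin_of_isOpen Metric.isOpen_ball hv, (hR v hv).fderiv])
      hv (Metric.mem_ball_self hε)
    simp only [R, Q, hp.1.2.1, κ.left_inv hg.1.1, sub_zero] at h1
    refine φ.injOn hp.2.2.2.1 hb.1 ?_
    rw [sub_eq_iff_eq_add] at h1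
    rw [h1]
    abel
  · intro b hb w
    have hv := hdiff g hg b hb
    have hp := hball' (κ g) hg.1.2 _ hv
    let dφ : EB →L[ℝ] EB := mfderiv 𝓘(ℝ, EB) 𝓘(ℝ, EB) φ b
    let dκ : EG →L[ℝ] EG := mfderiv 𝓘(ℝ, EG) 𝓘(ℝ, EG) κ (Ψ g b)
    let dΨ : EB →L[ℝ] EG := mfderiv 𝓘(ℝ, EB) 𝓘(ℝ, EG) (Ψ g) b
    have hφd : HasMFDerivAt 𝓘(ℝ, EB) 𝓘(ℝ, EB) (fun b => φ b - φ (q g)) b dφ := by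
      have h1 := ((hφat b hb).mdifferentiableAt (by simp)).hasMFDerivAt
      have h2 := h1.sub (hasMFDerivAt_const (φ (q g)) b)
      exact h2.congr_mfderiv (sub_zero _)
    have hT : HasMFDerivAt 𝓘(ℝ, EB) 𝓘(ℝ, EG) (fun b => S (κ g, φ b - φ (q g))) b
        ((X (S (κ g, φ b - φ (q g)))) ∘L dφ) :=
      HasMFDerivAt.comp (g := fun v => S (κ g, v)) b (hp.1.2.2.hasMFDerivAt) hφd
    have hΨκ : Ψ g b ∈ κ.source := κ.map_target hp.2.2.1
    have hΨd : MDifferentiableAt 𝓘(ℝ, EB) 𝓘(ℝ, EG) (Ψ g) b :=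
      ((hΨ.contMDiffAt ((hW.prod hU).mem_nhds ⟨hg, hb⟩)).comp b
        (contMDiffAt_const.prodMk contMDiffAt_id)).mdifferentiableAt (by simp)
    have hκd : MDifferentiableAt 𝓘(ℝ, EG) 𝓘(ℝ, EG) κ (Ψ g b) :=
      mdifferentiableAt_extChartAt (by rw [← extChartAt_source 𝓘(ℝ, EG)]; exact hΨκ)
    have hT' : HasMFDerivAt 𝓘(ℝ, EB) 𝓘(ℝ, EG) (fun b => S (κ g, φ b - φ (q g))) b (dκ ∘L dΨ) := by
      refine (hκd.hasMFDerivAt.comp b hΨd.hasMFDerivAt).congr_of_eventuallyEq ?_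
      filter_upwards [hU.mem_nhds hb] with y hy
      exact (κ.right_inv (hball' (κ g) hg.1.2 _ (hdiff g hg y hy)).2.2.1).symm
    have h1 : dκ (dΨ w) = X (S (κ g, φ b - φ (q g))) (dφ w) :=
      congrArg (fun L : EB →L[ℝ] EG => L w) (hasMFDerivAt_unique hT' hT)
    have h2 : dΨ w = dκ.inverse (X (S (κ g, φ b - φ (q g))) (dφ w)) := by
      rw [← h1]
      exact ((isInvertible_mfderiv_extChartAt hΨκ).inverse_apply_eq.2 rfl).symm
    have h3 := hp.2.2.2.2 (dφ w)
    have h4 : dΨ w ∈ (show Submodule ℝ EG from 𝓛 (Ψ g b)) := by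
      rw [h2]; exact h3
    exact h4
  · have hp := hball' (κ g) hg.1.2 0 (Metric.mem_ball_self hε)
    simp only [Ψ, sub_self, hp.1.2.1, κ.left_inv hg.1.1]

end Horizontal

namespace GroupBundle

/-! ### Products and inverses of horizontal sections -/

section FiberAlgebra

variable {B G : Type*} {q : G → B} [∀ b, Group (Fiber q b)]

/-- Inversion in the fibres. -/
def fiberInv (q : G → B) [∀ b, Group (Fiber q b)] (g : G) : G :=
  (((⟨g, rfl⟩ : Fiber q (q g))⁻¹ : Fiber q (q g)) : G)

theorem fiberComp_coe {b : B} (a a' : Fiber q b) :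
    fiberComp q (a, a') = ((a * a' : Fiber q b) : G) := by
  obtain ⟨g, hg⟩ := a
  obtain ⟨g', hg'⟩ := a'
  obtain rfl : q g' = b := hg'
  have h : q g = q g' := hg
  simp only [fiberComp, h, dif_pos]

theorem fiberInv_coe {b : B} (a : Fiber q b) : fiberInv q (a : G) = ((a⁻¹ : Fiber q b) : G) := by
  obtain ⟨g, hg⟩ := a
  obtain rfl : q g = b := hg
  rfl

theorem proj_fiberComp {g g' : G} (h : q g = q g') : q (fiberComp q (g, g')) = q g' := by
  rw [show fiberComp q (g, g') = _ from
    fiberComp_coe (⟨g, h⟩ : Fiber q (q g')) (⟨g', rfl⟩ : Fiber q (q g'))]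
  exact Subtype.prop ((⟨g, h⟩ : Fiber q (q g')) * ⟨g', rfl⟩)

theorem proj_fiberInv (g : G) : q (fiberInv q g) = q g :=
  Subtype.prop ((⟨g, rfl⟩ : Fiber q (q g))⁻¹)

theorem proj_one (b : B) : q ((1 : Fiber q b) : G) = b := Subtype.prop (1 : Fiber q b)

theorem fiberComp_fiberInv_self (g : G) :
    fiberComp q (fiberInv q g, g) = ((1 : Fiber q (q g)) : G) := by
  rw [show fiberComp q (fiberInv q g, g) = _ from
    fiberComp_coe ((⟨g, rfl⟩ : Fiber q (q g))⁻¹) ⟨g, rfl⟩, inv_mul_cancel]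

theorem eq_one_of_fiberComp_self {b : B} {g : G} (hg : q g = b) (h : fiberComp q (g, g) = g) :
    g = ((1 : Fiber q b) : G) := by
  subst hg
  rw [show fiberComp q (g, g) = _ from fiberComp_coe (⟨g, rfl⟩ : Fiber q (q g)) ⟨g, rfl⟩] at h
  have h1 : (⟨g, rfl⟩ : Fiber q (q g)) * ⟨g, rfl⟩ = ⟨g, rfl⟩ := Subtype.ext h
  exact congrArg Subtype.val (mul_eq_left.1 h1)

theorem eq_fiberInv_of_fiberComp_eq_one {b : B} {g g' : G} (hg : q g = b) (hg' : q g' = b)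
    (h : fiberComp q (g, g') = ((1 : Fiber q b) : G)) : g = fiberInv q g' := by
  subst hg'
  rw [show fiberComp q (g, g') = _ from fiberComp_coe (⟨g, hg⟩ : Fiber q (q g')) ⟨g', rfl⟩] at h
  have h1 : (⟨g, hg⟩ : Fiber q (q g')) * ⟨g', rfl⟩ = 1 := Subtype.ext h
  exact congrArg Subtype.val (eq_inv_of_mul_eq_one_left h1)

end FiberAlgebra

section

variable {EB : Type*} [NormedAddCommGroup EB] [NormedSpace ℝ EB]
  {EF : Type*} [NormedAddCommGroup EF] [NormedSpace ℝ EF]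
  {EG : Type*} [NormedAddCommGroup EG] [NormedSpace ℝ EG]
  {B : Type*} [TopologicalSpace B] [ChartedSpace EB B]
  {F : Type*} [TopologicalSpace F] [ChartedSpace EF F]
  {G : Type*} [TopologicalSpace G] [ChartedSpace EG G]
  {q : G → B} {𝓛 : Π g : G, Submodule ℝ (TangentSpace 𝓘(ℝ, EG) g)} {s s' : B → G}
  {U U' : Set B}

theorem IsSmoothBundle.contMDiff_proj
    (h : IsSmoothBundle (EB := EB) (EF := EF) (EG := EG) F q) :
    ContMDiff 𝓘(ℝ, EG) 𝓘(ℝ, EB) ∞ q := by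
  intro g
  obtain ⟨e, he, hs, -⟩ := h (q g)
  have hg : e.source ∈ 𝓝 g := e.open_source.mem_nhds (e.mem_source.2 he)
  refine (contMDiffAt_fst.comp g (hs.contMDiffAt hg)).congr_of_eventuallyEq ?_
  filter_upwards [hg] with g' hg'
  exact (e.coe_fst hg').symm

theorem IsHorizontalOn.of_locally (hU : IsOpen U)
    (h : ∀ b ∈ U, ∃ (s' : B → G) (U' : Set B), IsHorizontalOn (EB := EB) q 𝓛 s' U' ∧ b ∈ U' ∧
      s =ᶠ[𝓝 b] s') : IsHorizontalOn (EB := EB) q 𝓛 s U := by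
  refine ⟨hU, fun b hb => ?_, fun b hb => ?_, fun b hb w => ?_⟩ <;>
    obtain ⟨s', U', hs', hb', heq⟩ := h b hb
  · exact ((hs'.contMDiffAt hb').congr_of_eventuallyEq heq).contMDiffWithinAt
  · rw [heq.self_of_nhds, hs'.apply_eq b hb']
  · have h2 := hs'.mem b hb' w
    rw [← heq.mfderiv_eq] at h2
    exact mem_of_eq_of_mem (EG := EG) heq.self_of_nhds.symm h2

theorem IsHorizontalOn.mfderiv_proj (hq : ContMDiff 𝓘(ℝ, EG) 𝓘(ℝ, EB) ∞ q)
    (h : IsHorizontalOn (EB := EB) q 𝓛 s U) {b : B} (hb : b ∈ U) (w : EB) :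
    (mfderiv 𝓘(ℝ, EG) 𝓘(ℝ, EB) q (s b) (mfderiv 𝓘(ℝ, EB) 𝓘(ℝ, EG) s b w) : EB) = w := by
  have h1 := ((hq.mdifferentiable (by simp)) (s b)).hasMFDerivAt.comp b
    ((h.contMDiffAt hb).mdifferentiableAt (by simp)).hasMFDerivAt
  have h2 : HasMFDerivAt 𝓘(ℝ, EB) 𝓘(ℝ, EB) (q ∘ s) b
      (ContinuousLinearMap.id ℝ (TangentSpace 𝓘(ℝ, EB) b)) := by
    refine (hasMFDerivAt_id b).congr_of_eventuallyEq ?_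
    filter_upwards [h.isOpen.mem_nhds hb] with y hy
    exact h.apply_eq y hy
  exact congrArg (fun L : EB →L[ℝ] EB => L w) (hasMFDerivAt_unique h1 h2)

variable [∀ b, Group (Fiber q b)] [IsManifold 𝓘(ℝ, EG) ∞ G]

/-- The pair `(s, s')` maps into `G ×_B G`, and both velocities project to the same vector of `B`,
so the compatibility of `𝓛` with composition applies to its derivative. -/
theorem IsHorizontalOn.mul (hG : IsGroupBundle (EB := EB) (EF := EF) (EG := EG) F q)
    (h𝓛 : IsGroupConnection (EB := EB) q 𝓛) (h : IsHorizontalOn (EB := EB) q 𝓛 s U)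
    (h' : IsHorizontalOn (EB := EB) q 𝓛 s' U) :
    IsHorizontalOn (EB := EB) q 𝓛 (fun b => fiberComp q (s b, s' b)) U := by
  have hq := hG.bundle.contMDiff_proj
  have hmaps : MapsTo (fun b => (s b, s' b)) U (fiberProd q) := fun b hb => by
    change q (s b) = q (s' b)
    rw [h.apply_eq b hb, h'.apply_eq b hb]
  refine ⟨h.isOpen, hG.smooth_comp.comp (h.smooth.prodMk h'.smooth) hmaps, fun b hb => ?_,
    fun b hb w => ?_⟩
  · rw [proj_fiberComp (hmaps hb), h'.apply_eq b hb]
  · have h1 := ((h.contMDiffAt hb).mdifferentiableAt (by simp)).hasMFDerivAt.prodMk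
      ((h'.contMDiffAt hb).mdifferentiableAt (by simp)).hasMFDerivAt
    have h2 := (hG.smooth_comp.mdifferentiableOn (by simp) _ (hmaps hb)).hasMFDerivWithinAt
    have h3 := (h2.comp b h1.hasMFDerivWithinAt hmaps).hasMFDerivAt (h.isOpen.mem_nhds hb)
    have h4 := h𝓛.comp_mem (s b, s' b) (hmaps hb)
      (mfderiv 𝓘(ℝ, EB) 𝓘(ℝ, EG) s b w, mfderiv 𝓘(ℝ, EB) 𝓘(ℝ, EG) s' b w)
      ⟨h.mem b hb w, h'.mem b hb w,
        (h.mfderiv_proj hq hb w).trans (h'.mfderiv_proj hq hb w).symm⟩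
    have h5 := h3.mfderiv
    change mfderiv 𝓘(ℝ, EB) 𝓘(ℝ, EG) (fiberComp q ∘ fun b => (s b, s' b)) b w ∈ _
    rw [h5]
    exact h4

variable [FiniteDimensional ℝ EG] [IsManifold 𝓘(ℝ, EB) ∞ B] [CompleteSpace EB]

/-- If `s` is horizontal through the identity of `G_b`, then `s · s` is horizontal with the same
value at `b`. By uniqueness `s · s = s` near `b`, and the only idempotent of a group is its
identity. -/
theorem IsGroupConnection.isHorizontalOn_one
    (hG : IsGroupBundle (EB := EB) (EF := EF) (EG := EG) F q)
    (h𝓛 : IsGroupConnection (EB := EB) q 𝓛) :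
    IsHorizontalOn (EB := EB) q 𝓛 (fun b => ((1 : Fiber q b) : G)) univ := by
  have hq := hG.bundle.contMDiff_proj
  refine .of_locally isOpen_univ fun b _ => ?_
  obtain ⟨W, U, Ψ, -, hgW, -, -, -, hΨ⟩ := h𝓛.flat.exists_isHorizontalOn hq ((1 : Fiber q b) : G)
  obtain ⟨hbU, hs, hs1⟩ := hΨ _ hgW
  rw [proj_one (q := q) b] at hbU hs1
  refine ⟨_, U, hs, hbU, ?_⟩
  have h1 := (hs.mul hG h𝓛 hs).eventuallyEq h𝓛.flat hq hs hbU hbU (by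
    simp only [hs1, fiberComp_coe, mul_one])
  filter_upwards [h1, hs.isOpen.mem_nhds hbU] with y hy hyU
  exact (eq_one_of_fiberComp_self (hs.apply_eq y hyU) hy).symm

/-- A horizontal section through `(s b)⁻¹`, multiplied by `s`, agrees with the horizontal identity
section at `b`, hence near `b`. -/
theorem IsHorizontalOn.inv (hG : IsGroupBundle (EB := EB) (EF := EF) (EG := EG) F q)
    (h𝓛 : IsGroupConnection (EB := EB) q 𝓛) (h : IsHorizontalOn (EB := EB) q 𝓛 s U) :
    IsHorizontalOn (EB := EB) q 𝓛 (fun b => fiberInv q (s b)) U := by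
  have hq := hG.bundle.contMDiff_proj
  refine .of_locally h.isOpen fun b hb => ?_
  obtain ⟨W, U', Ψ, -, hgW, -, -, -, hΨ⟩ := h𝓛.flat.exists_isHorizontalOn hq (fiberInv q (s b))
  obtain ⟨hbU', hs, hs1⟩ := hΨ _ hgW
  rw [proj_fiberInv (q := q) (s b), h.apply_eq b hb] at hbU' hs1
  refine ⟨_, U', hs, hbU', ?_⟩
  have hUU : IsOpen (U' ∩ U) := hs.isOpen.inter h.isOpen
  have h1 := ((hs.mono hUU inter_subset_left).mul hG h𝓛
    (h.mono hUU inter_subset_right)).eventuallyEq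
    h𝓛.flat hq (h𝓛.isHorizontalOn_one hG) ⟨hbU', hb⟩ (mem_univ b) (by
      simp only [hs1, fiberComp_fiberInv_self]
      exact congrArg (fun b => ((1 : Fiber q b) : G)) (h.apply_eq b hb))
  filter_upwards [h1, hUU.mem_nhds ⟨hbU', hb⟩] with y hy hyU
  exact (eq_fiberInv_of_fiberComp_eq_one (hs.apply_eq y hyU.1) (h.apply_eq y hyU.2) hy).symm

end

/-! ### Completeness over small sets, one fibre component at a time -/

section LocalCompleteness

variable {EB : Type*} [NormedAddCommGroup EB] [NormedSpace ℝ EB]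
  {EF : Type*} [NormedAddCommGroup EF] [NormedSpace ℝ EF]
  {EG : Type*} [NormedAddCommGroup EG] [NormedSpace ℝ EG] [FiniteDimensional ℝ EG]
  {B : Type*} [TopologicalSpace B] [ChartedSpace EB B]
  {F : Type*} [TopologicalSpace F] [ChartedSpace EF F]
  {G : Type*} [TopologicalSpace G] [ChartedSpace EG G]
  {q : G → B} [∀ b, Group (Fiber q b)] {𝓛 : Π g : G, Submodule ℝ (TangentSpace 𝓘(ℝ, EG) g)}

omit [FiniteDimensional ℝ EG] in
theorem IsGroupBundle.continuousMul (hG : IsGroupBundle (EB := EB) (EF := EF) (EG := EG) F q)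
    (b : B) : ContinuousMul (Fiber q b) where
  continuous_mul := by
    refine continuous_induced_rng.2 ?_
    have h1 : Continuous fun p : Fiber q b × Fiber q b => fiberComp q ((p.1 : G), (p.2 : G)) :=
      hG.smooth_comp.continuousOn.comp_continuous (by fun_prop)
        fun p => p.1.2.trans p.2.2.symm
    exact h1.congr fun p => fiberComp_coe p.1 p.2

variable [CompleteSpace EB] [IsManifold 𝓘(ℝ, EB) ∞ B] [IsManifold 𝓘(ℝ, EG) ∞ G]

/-- Over a neighbourhood of `b₀` horizontal sections exist through the points of a clopen subgroup
of each fibre. -/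
theorem IsGroupConnection.exists_isClopen_subgroup
    (hG : IsGroupBundle (EB := EB) (EF := EF) (EG := EG) F q)
    (h𝓛 : IsGroupConnection (EB := EB) q 𝓛) (b₀ : B) :
    ∃ U : Set B, IsOpen U ∧ b₀ ∈ U ∧ ∀ b ∈ U, ∃ S : Subgroup (Fiber q b),
      IsClopen (S : Set (Fiber q b)) ∧
      ∀ a ∈ S, ∃ s, IsHorizontalOn (EB := EB) q 𝓛 s U ∧ s b = a := by
  have hq := hG.bundle.contMDiff_proj
  obtain ⟨W, U, Ψ, hW, h1W, hU, hqU, -, hΨ⟩ :=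
    h𝓛.flat.exists_isHorizontalOn hq ((1 : Fiber q b₀) : G)
  rw [proj_one (q := q) b₀] at hqU
  let V : Set B := U ∩ (fun b => ((1 : Fiber q b) : G)) ⁻¹' W
  have hV : IsOpen V := hU.inter (hW.preimage hG.smooth_one.continuous)
  refine ⟨V, hV, ⟨hqU, h1W⟩, fun b hb => ?_⟩
  -- The values at `b` of horizontal sections over `V` form a subgroup. It contains the
  -- neighbourhood `W ∩ G_b` of the identity, so it is open and therefore closed.
  let S : Subgroup (Fiber q b) :=
    { carrier := {a | ∃ s, IsHorizontalOn (EB := EB) q 𝓛 s V ∧ s b = a}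
      one_mem' := ⟨_, (h𝓛.isHorizontalOn_one hG).mono hV (subset_univ _), rfl⟩
      mul_mem' := by
        rintro a a' ⟨s, hs, hsa⟩ ⟨s', hs', hsa'⟩
        exact ⟨_, hs.mul hG h𝓛 hs', by simp only [hsa, hsa', fiberComp_coe]⟩
      inv_mem' := by
        rintro a ⟨s, hs, hsa⟩
        exact ⟨_, hs.inv hG h𝓛, by simp only [hsa, fiberInv_coe]⟩ }
  have := hG.continuousMul b
  have hS : IsOpen (S : Set (Fiber q b)) := by
    refine S.isOpen_of_mem_nhds (g := 1) ?_
    filter_upwards [continuous_subtype_val.continuousAt.preimage_mem_nhds (hW.mem_nhds hb.2)]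
      with a ha
    obtain ⟨-, h1, h2⟩ := hΨ a ha
    rw [show q a = b from a.2] at h2
    exact ⟨_, h1.mono hV inter_subset_left, h2⟩
  exact ⟨S, ⟨S.isClosed_of_isOpen hS, hS⟩, fun a ha => ha⟩

/-- Over a neighbourhood of `b₀`, which depends only on the connected component of `f` in the
typical fibre, horizontal sections exist through all points of this component. -/
theorem IsGroupConnection.exists_isHorizontalOn_connectedComponent
    (hG : IsGroupBundle (EB := EB) (EF := EF) (EG := EG) F q)
    (h𝓛 : IsGroupConnection (EB := EB) q 𝓛) (b₀ : B) :
    ∃ (e : Trivialization F q) (U : Set B), IsOpen U ∧ b₀ ∈ U ∧ U ⊆ e.baseSet ∧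
      ∀ f : F, ∃ U' ⊆ U, IsOpen U' ∧ b₀ ∈ U' ∧
        ∀ g, q g ∈ U' → (e g).2 ∈ connectedComponent f →
          ∃ s, IsHorizontalOn (EB := EB) q 𝓛 s U' ∧ s (q g) = g := by
  have hq := hG.bundle.contMDiff_proj
  obtain ⟨e, he, -⟩ := hG.bundle b₀
  obtain ⟨U, hU, hbU, hS⟩ := h𝓛.exists_isClopen_subgroup hG b₀
  refine ⟨e, U ∩ e.baseSet, hU.inter e.open_baseSet, ⟨hbU, he⟩, inter_subset_right, fun f => ?_⟩
  have hek : q (e.toOpenPartialHomeomorph.symm (b₀, f)) = b₀ := e.proj_symm_apply' he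
  obtain ⟨W, Uτ, Ψ, -, hkW, hUτ, hbτ, -, hΨ⟩ :=
    h𝓛.flat.exists_isHorizontalOn hq (e.toOpenPartialHomeomorph.symm (b₀, f))
  obtain ⟨-, hτ, hτb⟩ := hΨ _ hkW
  set τ := Ψ (e.toOpenPartialHomeomorph.symm (b₀, f))
  rw [hek] at hbτ hτb
  have : LocallyPathConnectedSpace B := ChartedSpace.locallyPathConnectedSpace EB B
  have hO : IsOpen (U ∩ e.baseSet ∩ Uτ) := (hU.inter e.open_baseSet).inter hUτ
  have hbO : b₀ ∈ U ∩ e.baseSet ∩ Uτ := ⟨⟨hbU, he⟩, hbτ⟩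
  have hsub := connectedComponentIn_subset (U ∩ e.baseSet ∩ Uτ) b₀
  have hU' := hO.connectedComponentIn (x := b₀)
  refine ⟨connectedComponentIn (U ∩ e.baseSet ∩ Uτ) b₀, hsub.trans inter_subset_left, hU',
    mem_connectedComponentIn hbO, fun g hg hgf => ?_⟩
  have hgO := hsub hg
  have hτ' := hτ.mono hU' (hsub.trans inter_subset_right)
  -- Over a connected set, `τ` cannot leave the component of `f` in the trivialization.
  have hτc : (e (τ (q g))).2 ∈ connectedComponent f := by
    have h1 : ContinuousOn (fun b => (e (τ b)).2)
        (connectedComponentIn (U ∩ e.baseSet ∩ Uτ) b₀) :=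
      (continuous_snd.comp_continuousOn e.toOpenPartialHomeomorph.continuousOn).comp
        hτ'.smooth.continuousOn fun b hb =>
        e.mem_source.2 (by rw [hτ'.apply_eq b hb]; exact (hsub hb).1.2)
    refine (isPreconnected_connectedComponentIn.image _ h1).subset_connectedComponent
      ⟨b₀, mem_connectedComponentIn hbO, ?_⟩ (mem_image_of_mem _ hg)
    simp only [hτb, e.apply_symm_apply' he]
  obtain ⟨S, hSc, hSs⟩ := hS (q g) hgO.1.1
  have := hG.continuousMul (q g)
  let t : Fiber q (q g) := ⟨τ (q g), hτ'.apply_eq _ hg⟩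
  let ψ := e.preimageSingletonHomeomorph hgO.1.2
  -- This clopen set, the coset `S t` seen in `F`, contains the point of `t` and hence the whole
  -- component of `f`. Thus `g = (g t⁻¹) t` with `g t⁻¹ ∈ S`, and a horizontal section through `g
  -- t⁻¹` times `τ` passes through `g`.
  have hclopen : IsClopen ((fun f' : F => ψ.symm f' * t⁻¹) ⁻¹' (S : Set (Fiber q (q g)))) :=
    hSc.preimage (ψ.symm.continuous.mul continuous_const)
  have hmem : (⟨g, rfl⟩ : Fiber q (q g)) * t⁻¹ ∈ S := by
    have h1 : connectedComponent (ψ t) ⊆ _ := hclopen.connectedComponent_subset (by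
      simp only [mem_preimage, ψ.symm_apply_apply, mul_inv_cancel]
      exact S.one_mem)
    have h2 : ψ ⟨g, rfl⟩ ∈ connectedComponent (ψ t) := by
      rw [connectedComponent_eq_iff_mem.2 (show ψ t ∈ connectedComponent f from hτc)]
      exact hgf
    have h3 := h1 h2
    simpa only [mem_preimage, ψ.symm_apply_apply, SetLike.mem_coe] using h3
  obtain ⟨s, hs, hsg⟩ := hSs _ hmem
  refine ⟨_, (hs.mono hU' fun b hb => (hsub hb).1.1).mul hG h𝓛 hτ', ?_⟩
  change fiberComp q (s (q g), (t : G)) = g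
  rw [hsg, fiberComp_coe, inv_mul_cancel_right]

end LocalCompleteness

/-! ### The leaf topology -/

section Leaf

variable {EB : Type*} [NormedAddCommGroup EB] [NormedSpace ℝ EB]
  {EG : Type*} [NormedAddCommGroup EG] [NormedSpace ℝ EG]
  {B : Type*} [TopologicalSpace B] [ChartedSpace EB B]
  {G : Type*} [TopologicalSpace G] [ChartedSpace EG G]

/-- The space `G`, with the topology for which the images of the horizontal sections form
a basis. -/
def LeafSpace (_ : Type*) (_ : G → B) (_ : Π g : G, Submodule ℝ (TangentSpace 𝓘(ℝ, EG) g)) :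
    Type _ := G

variable {q : G → B} {𝓛 : Π g : G, Submodule ℝ (TangentSpace 𝓘(ℝ, EG) g)} {s : B → G} {U : Set B}

/-- The identity map from the leaf space to `G`. -/
def LeafSpace.val (g : LeafSpace EB q 𝓛) : G := g

/-- The identity map from `G` to the leaf space. -/
def LeafSpace.mk (g : G) : LeafSpace EB q 𝓛 := g

/-- This is the finest topology making all horizontal sections continuous. That their images are
open in it is local uniqueness (`IsHorizontalOn.isOpen_image`). -/
instance : TopologicalSpace (LeafSpace EB q 𝓛) where
  IsOpen S := ∀ (s : B → G) (U : Set B), IsHorizontalOn (EB := EB) q 𝓛 s U →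
    IsOpen (U ∩ (fun b => (.mk (s b) : LeafSpace EB q 𝓛)) ⁻¹' S)
  isOpen_univ s U h := by simpa using h.isOpen
  isOpen_inter S S' hS hS' s U h := by
    rw [preimage_inter, inter_inter_distrib_left]
    exact (hS s U h).inter (hS' s U h)
  isOpen_sUnion C hC s U h := by
    rw [preimage_sUnion, inter_iUnion₂]
    exact isOpen_biUnion fun S hS => hC S hS s U h

theorem LeafSpace.continuous_val : Continuous (LeafSpace.val (EB := EB) (q := q) (𝓛 := 𝓛)) :=
  ⟨fun _ hO _ _ h => h.smooth.continuousOn.isOpen_inter_preimage h.isOpen hO⟩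

instance [T2Space G] : T2Space (LeafSpace EB q 𝓛) :=
  .of_injective_continuous (f := LeafSpace.val) (fun _ _ h => h) LeafSpace.continuous_val

theorem IsHorizontalOn.continuousOn_mk (h : IsHorizontalOn (EB := EB) q 𝓛 s U) :
    ContinuousOn (fun b => LeafSpace.mk (EB := EB) (q := q) (𝓛 := 𝓛) (s b)) U :=
  (continuousOn_open_iff h.isOpen).2 fun _ hS => hS s U h

variable [FiniteDimensional ℝ EG] [IsManifold 𝓘(ℝ, EB) ∞ B] [IsManifold 𝓘(ℝ, EG) ∞ G]

theorem IsHorizontalOn.isOpen_image (h𝓛 : IsFlatConnection (EB := EB) q 𝓛)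
    (hq : ContMDiff 𝓘(ℝ, EG) 𝓘(ℝ, EB) ∞ q) (h : IsHorizontalOn (EB := EB) q 𝓛 s U) :
    IsOpen ((fun b => LeafSpace.mk (EB := EB) (q := q) (𝓛 := 𝓛) (s b)) '' U) := by
  intro s' U' h'
  rw [isOpen_iff_mem_nhds]
  rintro b ⟨hb, b', hb', heq⟩
  have heq : s b' = s' b := heq
  obtain rfl : b' = b := by rw [← h.apply_eq b' hb', heq, h'.apply_eq b hb]
  filter_upwards [h.eventuallyEq h𝓛 hq h' hb' hb heq, h.isOpen.mem_nhds hb',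
    h'.isOpen.mem_nhds hb] with y hy hyU hyU'
  exact ⟨hyU', y, hyU, hy⟩

variable [CompleteSpace EB]

theorem IsFlatConnection.exists_isHorizontalOn_nhds (h𝓛 : IsFlatConnection (EB := EB) q 𝓛)
    (hq : ContMDiff 𝓘(ℝ, EG) 𝓘(ℝ, EB) ∞ q) (g : G) :
    ∃ s U, IsHorizontalOn (EB := EB) q 𝓛 s U ∧ q g ∈ U ∧ s (q g) = g := by
  obtain ⟨W, U, Ψ, -, hg, -, -, -, hΨ⟩ := h𝓛.exists_isHorizontalOn hq g
  obtain ⟨h1, h2, h3⟩ := hΨ g hg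
  exact ⟨_, U, h2, h1, h3⟩

theorem IsFlatConnection.isLocalHomeomorph_leafSpace (h𝓛 : IsFlatConnection (EB := EB) q 𝓛)
    (hq : ContMDiff 𝓘(ℝ, EG) 𝓘(ℝ, EB) ∞ q) :
    IsLocalHomeomorph fun g : LeafSpace EB q 𝓛 => q g.val := by
  refine IsLocalHomeomorph.mk _ fun g => ?_
  obtain ⟨s, U, hs, hgU, hsg⟩ := h𝓛.exists_isHorizontalOn_nhds hq g.val
  refine ⟨{ toFun := fun g => q g.val
            invFun := fun b => LeafSpace.mk (s b)
            source := (fun b => LeafSpace.mk (s b)) '' U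
            target := U
            map_source' := ?_
            map_target' := fun b hb => mem_image_of_mem _ hb
            left_inv' := ?_
            right_inv' := hs.apply_eq
            open_source := hs.isOpen_image h𝓛 hq
            open_target := hs.isOpen
            continuousOn_toFun := (hq.continuous.comp LeafSpace.continuous_val).continuousOn
            continuousOn_invFun := hs.continuousOn_mk }, ⟨_, hgU, hsg⟩, fun _ _ => rfl⟩
  · rintro _ ⟨b, hb, rfl⟩
    exact (hs.apply_eq b hb).symm ▸ hb
  · rintro _ ⟨b, hb, rfl⟩
    exact congrArg (fun b => LeafSpace.mk (s b)) (hs.apply_eq b hb)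

/-- A leafwise continuous section stays, near each point, in the open image of a horizontal section,
and so equals it there. -/
theorem IsFlatConnection.isHorizontalOn_of_continuous (h𝓛 : IsFlatConnection (EB := EB) q 𝓛)
    (hq : ContMDiff 𝓘(ℝ, EG) 𝓘(ℝ, EB) ∞ q) {σ : B → LeafSpace EB q 𝓛}
    (hσ : Continuous σ) (hqσ : ∀ b, q (σ b).val = b) :
    IsHorizontalOn (EB := EB) q 𝓛 (fun b => (σ b).val) univ := by
  refine .of_locally isOpen_univ fun b _ => ?_
  obtain ⟨s, U, hs, hgU, hsg⟩ := h𝓛.exists_isHorizontalOn_nhds hq (σ b).val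
  refine ⟨s, U, hs, by rwa [hqσ] at hgU, ?_⟩
  filter_upwards [hσ.continuousAt.preimage_mem_nhds
    ((hs.isOpen_image h𝓛 hq).mem_nhds ⟨_, hgU, hsg⟩)] with y hy
  obtain ⟨y', hy', heq⟩ := hy
  have heq : s y' = (σ y).val := heq
  obtain rfl : y' = y := by rw [← hs.apply_eq y' hy', heq, hqσ]
  exact heq.symm

end Leaf

/-! ### Path lifting and global horizontal sections -/

section Lifting

variable {EB : Type*} [NormedAddCommGroup EB] [NormedSpace ℝ EB] [CompleteSpace EB]
  {EF : Type*} [NormedAddCommGroup EF] [NormedSpace ℝ EF]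
  {EG : Type*} [NormedAddCommGroup EG] [NormedSpace ℝ EG] [FiniteDimensional ℝ EG]
  {B : Type*} [TopologicalSpace B] [ChartedSpace EB B] [IsManifold 𝓘(ℝ, EB) ∞ B]
  {F : Type*} [TopologicalSpace F] [ChartedSpace EF F]
  {G : Type*} [TopologicalSpace G] [T2Space G] [ChartedSpace EG G] [IsManifold 𝓘(ℝ, EG) ∞ G]
  {q : G → B} [∀ b, Group (Fiber q b)] {𝓛 : Π g : G, Submodule ℝ (TangentSpace 𝓘(ℝ, EG) g)}

/-- If lifts did not exist for all times, one could be continued past the supremum of the times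
reached. The path is constant before time `0`, so the initial value can be prescribed at `-1`,
strictly below that supremum. -/
theorem IsGroupConnection.exists_lift_Iic
    (hG : IsGroupBundle (EB := EB) (EF := EF) (EG := EG) F q)
    (h𝓛 : IsGroupConnection (EB := EB) q 𝓛) {γ : ℝ → B} (hγ : Continuous γ) (g : G)
    (hγg : ∀ t ≤ 0, γ t = q g) (T : ℝ) :
    ∃ Γ : ℝ → LeafSpace EB q 𝓛, ContinuousOn Γ (Iic T) ∧
      (∀ t ≤ T, q (Γ t).val = γ t) ∧ Γ (-1) = .mk g := by
  have hq := hG.bundle.contMDiff_proj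
  have hloc := h𝓛.flat.isLocalHomeomorph_leafSpace hq
  let A : Set ℝ := {T | ∃ Γ : ℝ → LeafSpace EB q 𝓛, ContinuousOn Γ (Iic T) ∧
      (∀ t ≤ T, q (Γ t).val = γ t) ∧ Γ (-1) = .mk g}
  have hA : ∀ t ∈ A, ∀ t' ≤ t, t' ∈ A := by
    rintro t ⟨Γ, h1, h2, h3⟩ t' ht
    exact ⟨Γ, h1.mono (Iic_subset_Iic.2 ht), fun r hr => h2 r (hr.trans ht), h3⟩
  have h0 : (0 : ℝ) ∈ A := ⟨fun _ => .mk g, continuousOn_const, fun t ht => (hγg t ht).symm, rfl⟩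
  change T ∈ A
  by_contra hT
  have hbdd : BddAbove A := ⟨T, fun t ht => le_of_not_ge fun h => hT (hA t ht T h)⟩
  have hlt : ∀ t < sSup A, t ∈ A := fun t ht => by
    obtain ⟨t', ht', hlt⟩ := exists_lt_of_lt_csSup ⟨0, h0⟩ ht
    exact hA t' ht' t hlt.le
  have hsup : 0 ≤ sSup A := le_csSup hbdd h0
  obtain ⟨e, U, hU, hbU, hUe, hcomp⟩ :=
    h𝓛.exists_isHorizontalOn_connectedComponent hG (γ (sSup A))
  obtain ⟨l, u, ⟨hl, hu⟩, hlu⟩ :=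
    mem_nhds_iff_exists_Ioo_subset.1 (hγ.continuousAt.preimage_mem_nhds (hU.mem_nhds hbU))
  obtain ⟨t₀, ht₀, ht₀'⟩ := exists_between (max_lt hl (show -1 < sSup A by linarith))
  obtain ⟨hlt₀, h1t₀⟩ := max_lt_iff.1 ht₀
  obtain ⟨Γ₀, hΓ₀, hqΓ₀, hgΓ₀⟩ := hlt t₀ ht₀'
  -- The component is fixed at time `t₀`; only then is `U'` known, and `t₁` chosen so close to the
  -- supremum that the path lies in `U'` from `t₁` on. Between `t₀` and `t₁` the lift does not
  -- change component, so a section over `U'` passes through `Γ t₁`.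
  obtain ⟨U', hUU, hU', hbU', hsec⟩ := hcomp (e (Γ₀ t₀).val).2
  obtain ⟨l', u', ⟨hl', hu'⟩, hlu'⟩ :=
    mem_nhds_iff_exists_Ioo_subset.1 (hγ.continuousAt.preimage_mem_nhds (hU'.mem_nhds hbU'))
  obtain ⟨t₁, ht₁, ht₁'⟩ := exists_between (max_lt hl' ht₀')
  obtain ⟨hlt₁, ht₀₁⟩ := max_lt_iff.1 ht₁
  obtain ⟨t₂, ht₂, ht₂'⟩ := exists_between hu'
  obtain ⟨Γ, hΓ, hqΓ, hgΓ⟩ := hlt t₁ ht₁'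
  have hΓΓ₀ : Γ t₀ = Γ₀ t₀ :=
    (T2Space.isSeparatedMap (fun g : LeafSpace EB q 𝓛 => q g.val)).eqOn_of_comp_eqOn
      hloc.isLocallyInjective isPreconnected_Iic (hΓ.mono (Iic_subset_Iic.2 ht₀₁.le)) hΓ₀
      (fun t ht => (hqΓ t (le_trans ht ht₀₁.le)).trans (hqΓ₀ t ht).symm) h1t₀.le
      (hgΓ.trans hgΓ₀.symm) self_mem_Iic
  have hmem : (e (Γ t₁).val).2 ∈ connectedComponent (e (Γ₀ t₀).val).2 := by
    have h1 : ContinuousOn (fun t => (e (Γ t).val).2) (Icc t₀ t₁) :=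
      (continuous_snd.comp_continuousOn e.toOpenPartialHomeomorph.continuousOn).comp
        (LeafSpace.continuous_val.comp_continuousOn (hΓ.mono fun t ht => ht.2)) fun t ht =>
          e.mem_source.2 (by
            rw [hqΓ t ht.2]
            exact hUe (hlu ⟨hlt₀.trans_le ht.1, ht.2.trans_lt (ht₁'.trans hu)⟩))
    refine (isPreconnected_Icc.image _ h1).subset_connectedComponent
      ⟨t₀, left_mem_Icc.2 ht₀₁.le, ?_⟩ (mem_image_of_mem _ (right_mem_Icc.2 ht₀₁.le))
    simp only [hΓΓ₀]
  have hqt₁ : q (Γ t₁).val = γ t₁ := hqΓ t₁ le_rfl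
  obtain ⟨s, hs, hst₁⟩ := hsec (Γ t₁).val
    (by rw [hqt₁]; exact hlu' ⟨hlt₁, ht₁'.trans hu'⟩) hmem
  rw [hqt₁] at hst₁
  have hγU' : MapsTo γ (Icc t₁ t₂) U' := fun t ht =>
    hlu' ⟨hlt₁.trans_le ht.1, ht.2.trans_lt ht₂'⟩
  refine (le_csSup hbdd (show t₂ ∈ A from ?_)).not_gt ht₂
  let Γ' : ℝ → LeafSpace EB q 𝓛 := fun t => if t ≤ t₁ then Γ t else .mk (s (γ t))
  have h1 : EqOn Γ' Γ (Iic t₁) := fun t ht => if_pos ht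
  have h2 : EqOn Γ' (fun t => .mk (s (γ t))) (Icc t₁ t₂) := fun t ht => by
    rcases ht.1.eq_or_lt with rfl | hlt
    · exact (h1 self_mem_Iic).trans hst₁.symm
    · exact if_neg hlt.not_ge
  refine ⟨Γ', ?_, fun t ht => ?_, ?_⟩
  · rw [← Iic_union_Icc_eq_Iic (ht₁'.trans ht₂).le]
    refine (hΓ.congr h1).union_of_isClosed (ContinuousOn.congr ?_ h2) isClosed_Iic isClosed_Icc
    exact hs.continuousOn_mk.comp hγ.continuousOn hγU'
  · rcases le_total t t₁ with hle | hle
    · rw [h1 hle, hqΓ t hle]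
    · rw [h2 ⟨hle, ht⟩]
      exact hs.apply_eq _ (hγU' ⟨hle, ht⟩)
  · exact (h1 (h1t₀.trans ht₀₁).le).trans hgΓ

open unitInterval in
theorem IsGroupConnection.exists_path_lift
    (hG : IsGroupBundle (EB := EB) (EF := EF) (EG := EG) F q)
    (h𝓛 : IsGroupConnection (EB := EB) q 𝓛) (γ : C(I, B)) (g : G) (hγg : γ 0 = q g) :
    ∃ Γ : C(I, LeafSpace EB q 𝓛), Γ 0 = .mk g ∧
      (fun g : LeafSpace EB q 𝓛 => q g.val) ∘ Γ = γ := by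
  have hpr : ∀ t ≤ (0 : ℝ), projIcc (0 : ℝ) 1 zero_le_one t = 0 := fun t ht =>
    projIcc_of_le_left _ ht
  obtain ⟨Γ, h1, h2, h3⟩ := h𝓛.exists_lift_Iic hG
    (γ := fun t => γ (projIcc (0 : ℝ) 1 zero_le_one t))
    (γ.continuous.comp continuous_projIcc) g (fun t ht => by rw [hpr t ht, hγg]) 1
  have hq := hG.bundle.contMDiff_proj
  have h4 : Γ 0 = .mk g :=
    (T2Space.isSeparatedMap (fun g : LeafSpace EB q 𝓛 => q g.val)).eqOn_of_comp_eqOn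
      (h𝓛.flat.isLocalHomeomorph_leafSpace hq).isLocallyInjective isPreconnected_Iic
      (h1.mono (Iic_subset_Iic.2 zero_le_one)) continuousOn_const
      (fun t (ht : t ≤ 0) => ((h2 t (ht.trans zero_le_one)).trans (by rw [hpr t ht, hγg]; rfl)))
      (show (-1 : ℝ) ≤ 0 by norm_num) h3 self_mem_Iic
  refine ⟨⟨fun t => Γ t, h1.comp_continuous continuous_subtype_val fun t => t.2.2⟩, h4, ?_⟩
  ext t
  exact (h2 t t.2.2).trans (by rw [projIcc_val])

open unitInterval in
/-- Over a simply connected base there is a global horizontal section through every point. -/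
theorem IsGroupConnection.exists_isHorizontalOn_univ [SimplyConnectedSpace B]
    (hG : IsGroupBundle (EB := EB) (EF := EF) (EG := EG) F q)
    (h𝓛 : IsGroupConnection (EB := EB) q 𝓛) (g : G) :
    ∃ s, IsHorizontalOn (EB := EB) q 𝓛 s univ ∧ s (q g) = g := by
  have hq := hG.bundle.contMDiff_proj
  have hloc := h𝓛.flat.isLocalHomeomorph_leafSpace hq
  have hsep := T2Space.isSeparatedMap (fun g : LeafSpace EB q 𝓛 => q g.val)
  have : LocallyPathConnectedSpace B := ChartedSpace.locallyPathConnectedSpace EB B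
  -- Lifting the identity of `B` requires lifts of paths whose endpoints depend only on the endpoint
  -- in `B`. The latter is monodromy along a homotopy, whose intermediate paths all lift.
  obtain ⟨s, ⟨hsg, hs⟩, -⟩ := hloc.existsUnique_continuousMap_lifts (ContinuousMap.id B) (q g)
    (.mk g) rfl (fun γ hγ => h𝓛.exists_path_lift hG γ g hγ) (by
      intro γ γ' Γ Γ' hγ hγ' hΓ hΓ' hl hl' h1
      let p : Path (q g) (γ 1) := ⟨γ, hγ, rfl⟩
      let p' : Path (q g) (γ 1) := ⟨γ', hγ', h1.symm⟩
      obtain ⟨H⟩ := SimplyConnectedSpace.paths_homotopic p p'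
      have hH : ∀ t, (H.toHomotopy.curry t : C(I, B)) 0 = q g := fun t => by
        simp
      choose L hL0 hL using fun t => h𝓛.exists_path_lift hG (H.toHomotopy.curry t) g (hH t)
      have h2 := hloc.monodromy_theorem hsep H L (fun t s => congrFun (hL t) s)
        (fun t => (hL0 t).trans (hL0 0).symm) 1
      have h3 : (L 0 : I → _) = Γ := hsep.eq_of_comp_eq hloc.isLocallyInjective
        (L 0).continuous Γ.continuous (by
          rw [hL, hl]
          ext t
          exact H.apply_zero t) 0 ((hL0 0).trans hΓ.symm)
      have h4 : (L 1 : I → _) = Γ' := hsep.eq_of_comp_eq hloc.isLocallyInjective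
        (L 1).continuous Γ'.continuous (by
          rw [hL, hl']
          ext t
          exact H.apply_one t) 0 ((hL0 1).trans hΓ'.symm)
      rw [← h3, ← h4, h2])
  exact ⟨_, h𝓛.flat.isHorizontalOn_of_continuous hq s.continuous fun b => congrFun hs b, hsg⟩

end Lifting

/-! ### Smoothness of parallel transport -/

section

variable {EB : Type*} [NormedAddCommGroup EB] [NormedSpace ℝ EB]
  {EF : Type*} [NormedAddCommGroup EF] [NormedSpace ℝ EF]
  {EG : Type*} [NormedAddCommGroup EG] [NormedSpace ℝ EG]
  {B : Type*} [TopologicalSpace B] [ChartedSpace EB B]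
  {F : Type*} [TopologicalSpace F] [ChartedSpace EF F]
  {G : Type*} [TopologicalSpace G] [ChartedSpace EG G]
  {q : G → B}

section Group

variable [∀ b, Group (Fiber q b)]

theorem IsGroupBundle.contMDiffAt_fiberComp
    (hG : IsGroupBundle (EB := EB) (EF := EF) (EG := EG) F q)
    {E : Type*} [NormedAddCommGroup E] [NormedSpace ℝ E]
    {H : Type*} [TopologicalSpace H] {I : ModelWithCorners ℝ E H}
    {M : Type*} [TopologicalSpace M] [ChartedSpace H M] {f f' : M → G} {x : M}
    (hf : ContMDiffAt I 𝓘(ℝ, EG) ∞ f x) (hf' : ContMDiffAt I 𝓘(ℝ, EG) ∞ f' x)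
    (h : ∀ y, q (f y) = q (f' y)) :
    ContMDiffAt I 𝓘(ℝ, EG) ∞ (fun y => fiberComp q (f y, f' y)) x :=
  ContMDiffWithinAt.comp (g := fiberComp q) x (hG.smooth_comp _ (h x)) (hf.prodMk hf')
    fun y _ => h y

/-- The fibres of a group bundle are Lie groups. -/
theorem IsGroupBundle.lieGroup [IsManifold 𝓘(ℝ, EF) ∞ F]
    (hG : IsGroupBundle (EB := EB) (EF := EF) (EG := EG) F q) (x : B) :
    letI : ChartedSpace EF (Fiber q x) := hG.bundle.fiberChartedSpace x
    LieGroup 𝓘(ℝ, EF) ∞ (Fiber q x) := by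
  let _ : ChartedSpace EF (Fiber q x) := hG.bundle.fiberChartedSpace x
  have hcoe : ContMDiff 𝓘(ℝ, EF) 𝓘(ℝ, EG) ∞ (fun a : Fiber q x => (a : G)) :=
    (contMDiff_fiber_iff hG.bundle x id).1 contMDiff_id
  have hmfd : IsManifold 𝓘(ℝ, EF) ∞ (Fiber q x) :=
    { compatible := by
        rintro _ _ ⟨c, hc, rfl⟩ ⟨c', hc', rfl⟩
        have h1 := (contDiffGroupoid ∞ 𝓘(ℝ, EF)).compatible hc hc'
        convert h1 using 1
        ext <;> simp }
  exact
    { contMDiff_mul := by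
        refine (contMDiff_fiber_iff hG.bundle x _).2 fun p => ?_
        refine (hG.contMDiffAt_fiberComp (hcoe.comp contMDiff_fst p) (hcoe.comp contMDiff_snd p)
          fun p => p.1.2.trans p.2.2.symm).congr_of_eventuallyEq (.of_forall fun p => ?_)
        exact (fiberComp_coe p.1 p.2).symm
      contMDiff_inv := by
        refine (contMDiff_fiber_iff hG.bundle x _).2 ?_
        exact (hG.smooth_inv.comp hcoe).congr fun a => (fiberInv_coe a).symm }

end Group

variable [FiniteDimensional ℝ EG] [IsManifold 𝓘(ℝ, EB) ∞ B] [T2Space G]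
  [IsManifold 𝓘(ℝ, EG) ∞ G] {𝓛 : Π g : G, Submodule ℝ (TangentSpace 𝓘(ℝ, EG) g)}
  {P : G → B → G} {s : B → G}

/-- Applied to `P g` itself, this is the transport law `P (P g b) = P g`. -/
theorem IsFlatConnection.eq_of_isHorizontalOn_univ [PreconnectedSpace B]
    (h𝓛 : IsFlatConnection (EB := EB) q 𝓛) (hq : ContMDiff 𝓘(ℝ, EG) 𝓘(ℝ, EB) ∞ q)
    (hP : ∀ g, IsHorizontalOn (EB := EB) q 𝓛 (P g) univ) (hPg : ∀ g, P g (q g) = g)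
    (hs : IsHorizontalOn (EB := EB) q 𝓛 s univ) (b : B) : P (s b) = s := by
  have h1 := hPg (s b)
  rw [hs.apply_eq b (mem_univ b)] at h1
  exact funext fun y => (hP (s b)).eqOn h𝓛 hq hs isPreconnected_univ (mem_univ b) h1 (mem_univ y)

variable [CompleteSpace EB]

/-- Over a connected neighbourhood of `q g₀`, transport coincides with the smooth local family of
horizontal sections. -/
theorem IsFlatConnection.exists_contMDiffOn_transport
    (h𝓛 : IsFlatConnection (EB := EB) q 𝓛) (hq : ContMDiff 𝓘(ℝ, EG) 𝓘(ℝ, EB) ∞ q)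
    (hP : ∀ g, IsHorizontalOn (EB := EB) q 𝓛 (P g) univ) (hPg : ∀ g, P g (q g) = g) (g₀ : G) :
    ∃ (W : Set G) (U : Set B), IsOpen W ∧ g₀ ∈ W ∧ IsOpen U ∧ q g₀ ∈ U ∧
      ContMDiffOn (𝓘(ℝ, EG).prod 𝓘(ℝ, EB)) 𝓘(ℝ, EG) ∞ (fun p : G × B => P p.1 p.2) (W ×ˢ U) := by
  obtain ⟨W, U, Ψ, hW, hgW, hU, hgU, hΨ, h⟩ := h𝓛.exists_isHorizontalOn hq g₀
  have : LocallyPathConnectedSpace B := ChartedSpace.locallyPathConnectedSpace EB B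
  have hsub := connectedComponentIn_subset U (q g₀)
  have hU' := hU.connectedComponentIn (x := q g₀)
  refine ⟨W ∩ q ⁻¹' connectedComponentIn U (q g₀), connectedComponentIn U (q g₀),
    hW.inter (hU'.preimage hq.continuous), ⟨hgW, mem_connectedComponentIn hgU⟩, hU',
    mem_connectedComponentIn hgU, ?_⟩
  refine (hΨ.mono (prod_mono inter_subset_left hsub)).congr fun p hp => ?_
  obtain ⟨-, h1, h2⟩ := h p.1 hp.1.1
  exact ((hP p.1).mono hU' (subset_univ _)).eqOn h𝓛 hq (h1.mono hU' hsub)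
    isPreconnected_connectedComponentIn hp.1.2 ((hPg _).trans h2.symm) hp.2

variable [∀ b, Group (Fiber q b)]

/-- The set of `b` with this property is open, contains `b₀` and is closed: transport to points near
a limit `b` factors through some `b'` in the set, followed by local transport near the identity of
`G_b`. The identity section being horizontal keeps the intermediate point near the identity. -/
theorem IsGroupConnection.eventually_contMDiffAt_transport_one [PreconnectedSpace B]
    (hG : IsGroupBundle (EB := EB) (EF := EF) (EG := EG) F q)
    (h𝓛 : IsGroupConnection (EB := EB) q 𝓛)
    (hP : ∀ g, IsHorizontalOn (EB := EB) q 𝓛 (P g) univ) (hPg : ∀ g, P g (q g) = g) (b₀ b : B) :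
    ∀ᶠ p : G × B in 𝓝 (((1 : Fiber q b₀) : G), b),
      ContMDiffAt (𝓘(ℝ, EG).prod 𝓘(ℝ, EB)) 𝓘(ℝ, EG) ∞ (fun p : G × B => P p.1 p.2) p := by
  have hq := hG.bundle.contMDiff_proj
  have hone := h𝓛.isHorizontalOn_one hG
  have hPP : ∀ g b, P (P g b) = P g := fun g b =>
    h𝓛.flat.eq_of_isHorizontalOn_univ hq hP hPg (hP g) b
  have hP1 : ∀ b, P ((1 : Fiber q b₀) : G) b = ((1 : Fiber q b) : G) := fun b =>
    congrFun (h𝓛.flat.eq_of_isHorizontalOn_univ hq hP hPg hone b₀) b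
  let T : Set B := {b | ∀ᶠ p : G × B in 𝓝 (((1 : Fiber q b₀) : G), b),
      ContMDiffAt (𝓘(ℝ, EG).prod 𝓘(ℝ, EB)) 𝓘(ℝ, EG) ∞ (fun p : G × B => P p.1 p.2) p}
  have hT : IsOpen T := isOpen_setOfPred_eventually_nhds.preimage (Continuous.prodMk_right _)
  have hloc : ∀ b, ∃ (W : Set G) (U : Set B), IsOpen W ∧ ((1 : Fiber q b) : G) ∈ W ∧ IsOpen U ∧
      b ∈ U ∧ ContMDiffOn (𝓘(ℝ, EG).prod 𝓘(ℝ, EB)) 𝓘(ℝ, EG) ∞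
        (fun p : G × B => P p.1 p.2) (W ×ˢ U) := fun b => by
    have h1 := h𝓛.flat.exists_contMDiffOn_transport hq hP hPg ((1 : Fiber q b) : G)
    rwa [proj_one (q := q) b] at h1
  have hT₀ : b₀ ∈ T := by
    obtain ⟨W, U, hW, h1W, hU, hbU, h⟩ := hloc b₀
    filter_upwards [(hW.prod hU).mem_nhds ⟨h1W, hbU⟩] with p hp
    exact h.contMDiffAt ((hW.prod hU).mem_nhds hp)
  have hTc : IsClosed T := by
    refine isClosed_of_closure_subset fun b hb => ?_
    obtain ⟨W, U, hW, h1W, hU, hbU, h⟩ := hloc b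
    obtain ⟨b', ⟨hbU', h1W'⟩, hbT⟩ := mem_closure_iff.1 hb
      (U ∩ (fun b => ((1 : Fiber q b) : G)) ⁻¹' W)
      (hU.inter (hW.preimage hG.smooth_one.continuous)) ⟨hbU, h1W⟩
    have h1 : ∀ᶠ g in 𝓝 ((1 : Fiber q b₀) : G), ContMDiffAt (𝓘(ℝ, EG).prod 𝓘(ℝ, EB)) 𝓘(ℝ, EG) ∞
        (fun p : G × B => P p.1 p.2) (g, b') :=
      (Continuous.prodMk_left b').continuousAt.eventually hbT
    have h2 : ContMDiffAt 𝓘(ℝ, EG) 𝓘(ℝ, EG) ∞ (fun g => P g b') ((1 : Fiber q b₀) : G) :=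
      ContMDiffAt.comp (g := fun p : G × B => P p.1 p.2) ((1 : Fiber q b₀) : G)
        h1.self_of_nhds (contMDiffAt_id.prodMk contMDiffAt_const)
    have h3 : ∀ᶠ g in 𝓝 ((1 : Fiber q b₀) : G), P g b' ∈ W :=
      h2.continuousAt.preimage_mem_nhds (hW.mem_nhds (by rw [hP1]; exact h1W'))
    change ∀ᶠ p : G × B in 𝓝 (((1 : Fiber q b₀) : G), b), _
    rw [nhds_prod_eq]
    filter_upwards [(h1.and h3).prod_mk (hU.mem_nhds hbU)] with p hp
    have hpWU : (P p.1 b', p.2) ∈ W ×ˢ U := ⟨hp.1.2, hp.2⟩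
    have h4 : ContMDiffAt (𝓘(ℝ, EG).prod 𝓘(ℝ, EB)) 𝓘(ℝ, EG) ∞ (fun p : G × B => P p.1 b') p :=
      ContMDiffAt.comp (g := fun p : G × B => P p.1 p.2) p hp.1.1
        (contMDiffAt_fst.prodMk contMDiffAt_const)
    have h5 : ContMDiffAt (𝓘(ℝ, EG).prod 𝓘(ℝ, EB)) 𝓘(ℝ, EG) ∞
        (fun p : G × B => P (P p.1 b') p.2) p :=
      ContMDiffAt.comp (g := fun p : G × B => P p.1 p.2) p
        (h.contMDiffAt ((hW.prod hU).mem_nhds hpWU)) (h4.prodMk contMDiffAt_snd)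
    simpa only [hPP] using h5
  have h1 : T = univ := IsClopen.eq_univ ⟨hTc, hT⟩ ⟨b₀, hT₀⟩
  exact (h1 ▸ mem_univ b : b ∈ T)

/-- Parallel transport depends smoothly on the initial point. -/
theorem IsGroupConnection.contMDiff_transport [PreconnectedSpace B]
    (hG : IsGroupBundle (EB := EB) (EF := EF) (EG := EG) F q)
    (h𝓛 : IsGroupConnection (EB := EB) q 𝓛)
    (hP : ∀ g, IsHorizontalOn (EB := EB) q 𝓛 (P g) univ) (hPg : ∀ g, P g (q g) = g) :
    ContMDiff (𝓘(ℝ, EG).prod 𝓘(ℝ, EB)) 𝓘(ℝ, EG) ∞ (fun p : G × B => P p.1 p.2) := by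
  have hq := hG.bundle.contMDiff_proj
  rintro ⟨g₀, b⟩
  let τ := P g₀
  have hτ : ContMDiff 𝓘(ℝ, EB) 𝓘(ℝ, EG) ∞ τ := contMDiffOn_univ.1 (hP g₀).smooth
  have hqτ : ∀ b, q (τ b) = b := fun b => (hP g₀).apply_eq b (mem_univ b)
  have hqh : ∀ g, q g = q (fiberInv q (τ (q g))) := fun g =>
    ((proj_fiberInv (q := q) _).trans (hqτ _)).symm
  -- Right translation by the inverse of the horizontal section `τ` moves `g₀` to the identity,
  -- where smoothness is known.
  let h : G → G := fun g => fiberComp q (g, fiberInv q (τ (q g)))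
  have hh : ContMDiffAt 𝓘(ℝ, EG) 𝓘(ℝ, EG) ∞ h g₀ :=
    hG.contMDiffAt_fiberComp contMDiffAt_id ((hG.smooth_inv.comp (hτ.comp hq)) g₀) hqh
  have hqhg : ∀ g, q (h g) = q g := fun g => by
    rw [proj_fiberComp (hqh g), ← hqh]
  have hh₀ : h g₀ = ((1 : Fiber q (q g₀)) : G) := by
    simp only [h, τ, hPg]
    exact (fiberComp_coe (⟨g₀, rfl⟩ : Fiber q (q g₀)) (⟨g₀, rfl⟩ : Fiber q (q g₀))⁻¹).trans
      (by rw [mul_inv_cancel])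
  have hhτ : ∀ g, fiberComp q (h g, τ (q g)) = g := fun g => by
    let a : Fiber q (q g) := ⟨g, rfl⟩
    let t : Fiber q (q g) := ⟨τ (q g), hqτ _⟩
    change fiberComp q (fiberComp q ((a : G), fiberInv q (t : G)), (t : G)) = a
    rw [fiberInv_coe, fiberComp_coe, fiberComp_coe, inv_mul_cancel_right]
  -- The product of `P (h g)` and `τ` is horizontal with value `h g · τ (q g) = g` over `q g`, so it
  -- is `P g`.
  have key : ∀ p : G × B, P p.1 p.2 = fiberComp q (P (h p.1) p.2, τ p.2) := by
    rintro ⟨g, b⟩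
    have h1 := h𝓛.flat.eq_of_isHorizontalOn_univ hq hP hPg ((hP (h g)).mul hG h𝓛 (hP g₀)) (q g)
    have h2 : P (h g) (q g) = h g := by
      conv_lhs => rw [← hqhg g]
      exact hPg _
    simp only [h2] at h1
    rw [show fiberComp q (h g, P g₀ (q g)) = g from hhτ g] at h1
    exact congrFun h1 b
  have h1 : ContMDiffAt (𝓘(ℝ, EG).prod 𝓘(ℝ, EB)) 𝓘(ℝ, EG) ∞ (fun p : G × B => P p.1 p.2)
      (h g₀, b) := by
    rw [hh₀]
    exact (h𝓛.eventually_contMDiffAt_transport_one hG hP hPg (q g₀) b).self_of_nhds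
  have h2 : ContMDiffAt (𝓘(ℝ, EG).prod 𝓘(ℝ, EB)) 𝓘(ℝ, EG) ∞ (fun p : G × B => P (h p.1) p.2)
      (g₀, b) :=
    ContMDiffAt.comp (g := fun p : G × B => P p.1 p.2) (g₀, b) h1
      ((ContMDiffAt.comp (g := h) (g₀, b) hh contMDiffAt_fst).prodMk contMDiffAt_snd)
  refine (hG.contMDiffAt_fiberComp h2 (hτ.comp contMDiff_snd (g₀, b)) fun p => ?_)
    |>.congr_of_eventuallyEq (.of_forall key)
  exact ((hP _).apply_eq _ (mem_univ _)).trans (hqτ _).symm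

end

/-! ### The product foliation and the trivialization -/

section

variable {EB : Type*} [NormedAddCommGroup EB] [NormedSpace ℝ EB]
  {EF : Type*} [NormedAddCommGroup EF] [NormedSpace ℝ EF]
  {EG : Type*} [NormedAddCommGroup EG] [NormedSpace ℝ EG]
  {B : Type*} [TopologicalSpace B] [ChartedSpace EB B]
  {G : Type*} [TopologicalSpace G] [ChartedSpace EG G] [IsManifold 𝓘(ℝ, EG) ∞ G]
  {q : G → B} {𝓛 : Π g : G, Submodule ℝ (TangentSpace 𝓘(ℝ, EG) g)}
  {X : Type*} [TopologicalSpace X] [ChartedSpace EF X]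

/-- A diffeomorphism onto `G` whose partial maps on the base are horizontal sections identifies
the product foliation with `𝓛`. -/
theorem IsFlatConnection.isFoliatedMap_of_isHorizontalOn
    (h𝓛 : IsFlatConnection (EB := EB) q 𝓛) (hq : ContMDiff 𝓘(ℝ, EG) 𝓘(ℝ, EB) ∞ q)
    {Φ : X × B → G} (hΦ : ContMDiff (𝓘(ℝ, EF).prod 𝓘(ℝ, EB)) 𝓘(ℝ, EG) ∞ Φ)
    (hhor : ∀ a, IsHorizontalOn (EB := EB) q 𝓛 (fun b => Φ (a, b)) univ) :
    IsFoliatedMap (𝓘(ℝ, EF).prod 𝓘(ℝ, EB)) 𝓘(ℝ, EG) (zeroProdTop 𝓘(ℝ, EF) 𝓘(ℝ, EB) X B) 𝓛 Φ := by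
  refine ⟨hΦ, fun ⟨a, b⟩ => ?_⟩
  let dΦ : EF × EB →L[ℝ] EG := mfderiv (𝓘(ℝ, EF).prod 𝓘(ℝ, EB)) 𝓘(ℝ, EG) Φ (a, b)
  let ds : EB →L[ℝ] EG := mfderiv 𝓘(ℝ, EB) 𝓘(ℝ, EG) (fun b => Φ (a, b)) b
  let dq : EG →L[ℝ] EB := mfderiv 𝓘(ℝ, EG) 𝓘(ℝ, EB) q (Φ (a, b))
  let L : Submodule ℝ EG := 𝓛 (Φ (a, b))
  have h1 : ∀ w, dΦ (0, w) = ds w := fun w => by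
    have h2 : HasMFDerivAt 𝓘(ℝ, EB) 𝓘(ℝ, EG) (fun b => Φ (a, b)) b _ :=
      HasMFDerivAt.comp (g := Φ) b (hΦ.mdifferentiable (by simp) (a, b)).hasMFDerivAt
        ((hasMFDerivAt_const a b).prodMk (hasMFDerivAt_id b))
    exact congrArg (fun L : EB →L[ℝ] EG => L w) h2.mfderiv.symm
  have hds : ∀ w, ds w ∈ L := (hhor a).mem b (mem_univ b)
  have hdq : ∀ w, dq (ds w) = w := (hhor a).mfderiv_proj hq (mem_univ b)
  have hinj : InjOn dq L := (h𝓛.bijOn (Φ (a, b))).injOn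
  change Submodule.map dΦ.toLinearMap (Submodule.prod ⊥ ⊤) = L
  -- For surjectivity, `v ∈ 𝓛` and the image of `(0, dq v)` are horizontal with the same projection,
  -- hence equal.
  refine le_antisymm ?_ fun v hv => ⟨(0, dq v), ⟨rfl, trivial⟩, ?_⟩
  · rintro _ ⟨⟨u, w⟩, ⟨hu, -⟩, rfl⟩
    obtain rfl : u = 0 := hu
    exact (h1 w).symm ▸ hds w
  · exact (h1 _).trans (hinj (hds _) hv (hdq _))

end

theorem IsFoliatedMap.symm_diffeomorph
    {E : Type*} [NormedAddCommGroup E] [NormedSpace ℝ E]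
    {H : Type*} [TopologicalSpace H] {I : ModelWithCorners ℝ E H}
    {M : Type*} [TopologicalSpace M] [ChartedSpace H M]
    {E' : Type*} [NormedAddCommGroup E'] [NormedSpace ℝ E']
    {H' : Type*} [TopologicalSpace H'] {I' : ModelWithCorners ℝ E' H'}
    {M' : Type*} [TopologicalSpace M'] [ChartedSpace H' M']
    {𝓓 : Π p : M, Submodule ℝ (TangentSpace I p)} {𝓓' : Π p : M', Submodule ℝ (TangentSpace I' p)}
    (Φ : Diffeomorph I I' M M' ∞) (h : IsFoliatedMap I I' 𝓓 𝓓' Φ) :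
    IsFoliatedMap I' I 𝓓' 𝓓 Φ.symm := by
  refine ⟨Φ.symm.contMDiff, fun p' => ?_⟩
  obtain ⟨p, rfl⟩ : ∃ p, p' = Φ p := ⟨Φ.symm p', (Φ.apply_symm_apply p').symm⟩
  let A : E →L[ℝ] E' := mfderiv I I' Φ p
  let A' : E' →L[ℝ] E := mfderiv I' I Φ.symm (Φ p)
  let D : M → Submodule ℝ E := 𝓓
  let D' : Submodule ℝ E' := 𝓓' (Φ p)
  have h1 : Submodule.map A.toLinearMap (D p) = D' := h.2 p
  have h2 : HasMFDerivAt I I (Φ.symm ∘ Φ) p (A' ∘L A) :=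
    HasMFDerivAt.comp p (Φ.symm.contMDiff.mdifferentiable (by simp) (Φ p)).hasMFDerivAt
      (Φ.contMDiff.mdifferentiable (by simp) p).hasMFDerivAt
  have h3 : A' ∘L A = .id ℝ E := by
    refine hasMFDerivAt_unique h2 ((hasMFDerivAt_id p).congr_of_eventuallyEq (.of_forall ?_))
    exact fun y => Φ.symm_apply_apply y
  have h4 : D (Φ.symm (Φ p)) = D p := by rw [Φ.symm_apply_apply]
  change Submodule.map A'.toLinearMap D' = D (Φ.symm (Φ p))
  rw [h4, ← h1, ← Submodule.map_comp, ← ContinuousLinearMap.toLinearMap_comp, h3]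
  exact Submodule.map_id _

end GroupBundle

end

theorem mainTheorem9
    {EB : Type*} [NormedAddCommGroup EB] [NormedSpace ℝ EB] [FiniteDimensional ℝ EB]
    {EF : Type*} [NormedAddCommGroup EF] [NormedSpace ℝ EF] [FiniteDimensional ℝ EF]
    {EG : Type*} [NormedAddCommGroup EG] [NormedSpace ℝ EG] [FiniteDimensional ℝ EG]
    {B : Type*} [TopologicalSpace B] [T2Space B] [ChartedSpace EB B] [IsManifold 𝓘(ℝ, EB) ∞ B]
    {F : Type*} [TopologicalSpace F] [ChartedSpace EF F] [IsManifold 𝓘(ℝ, EF) ∞ F]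
    {G : Type*} [TopologicalSpace G] [T2Space G] [ChartedSpace EG G] [IsManifold 𝓘(ℝ, EG) ∞ G]
    [SimplyConnectedSpace B]
    (q : G → B) [∀ b, Group (Fiber q b)]
    (hG : IsGroupBundle (EB := EB) (EF := EF) (EG := EG) F q)
    (𝓛 : Π g : G, Submodule ℝ (TangentSpace 𝓘(ℝ, EG) g))
    (h𝓛 : IsGroupConnection (EB := EB) q 𝓛)
    (x : B) :
    letI : ChartedSpace EF (Fiber q x) := hG.bundle.fiberChartedSpace x
    LieGroup 𝓘(ℝ, EF) ∞ (Fiber q x) ∧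
    ∃ Φ : Diffeomorph (𝓘(ℝ, EF).prod 𝓘(ℝ, EB)) 𝓘(ℝ, EG) (Fiber q x × B) G ∞,
      (∀ g b, q (Φ (g, b)) = b) ∧
      (∀ g g' b, Φ (g * g', b) = fiberComp q (Φ (g, b), Φ (g', b))) ∧
      IsFoliatedMap (𝓘(ℝ, EF).prod 𝓘(ℝ, EB)) 𝓘(ℝ, EG)
        (zeroProdTop 𝓘(ℝ, EF) 𝓘(ℝ, EB) (Fiber q x) B) 𝓛 Φ ∧
      IsFoliatedMap 𝓘(ℝ, EG) (𝓘(ℝ, EF).prod 𝓘(ℝ, EB))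
        𝓛 (zeroProdTop 𝓘(ℝ, EF) 𝓘(ℝ, EB) (Fiber q x) B) Φ.symm := by
  refine ⟨hG.lieGroup x, ?_⟩
  let _ : ChartedSpace EF (Fiber q x) := hG.bundle.fiberChartedSpace x
  have : CompleteSpace EB := FiniteDimensional.complete ℝ EB
  have hq := hG.bundle.contMDiff_proj
  choose P hP hPg using h𝓛.exists_isHorizontalOn_univ hG
  have hPs := h𝓛.contMDiff_transport hG hP hPg
  have huniq := fun {s : B → G} (hs : IsHorizontalOn (EB := EB) q 𝓛 s univ) (b : B) =>
    h𝓛.flat.eq_of_isHorizontalOn_univ hq hP hPg hs b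
  have hqP : ∀ g b, q (P g b) = b := fun g b => (hP g).apply_eq b (mem_univ b)
  have hPx : ∀ a : Fiber q x, P a x = a := fun a => by
    have h1 := hPg (a : G)
    rwa [show q a = x from a.2] at h1
  have hcoe : ContMDiff 𝓘(ℝ, EF) 𝓘(ℝ, EG) ∞ (fun a : Fiber q x => (a : G)) :=
    (contMDiff_fiber_iff hG.bundle x id).1 contMDiff_id
  let Φ : Diffeomorph (𝓘(ℝ, EF).prod 𝓘(ℝ, EB)) 𝓘(ℝ, EG) (Fiber q x × B) G ∞ :=
    { toFun := fun p => P p.1 p.2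
      invFun := fun g => (⟨P g x, hqP g x⟩, q g)
      left_inv := fun p => Prod.ext
        (Subtype.ext ((congrFun (huniq (hP p.1) p.2) x).trans (hPx p.1))) (hqP p.1 p.2)
      right_inv := fun g => (congrFun (huniq (hP g) x) (q g)).trans (hPg g)
      contMDiff_toFun := hPs.comp ((hcoe.comp contMDiff_fst).prodMk contMDiff_snd)
      contMDiff_invFun := ContMDiff.prodMk ((contMDiff_fiber_iff hG.bundle x _).2
        (hPs.comp (contMDiff_id.prodMk contMDiff_const))) hq }
  have hΦ := h𝓛.flat.isFoliatedMap_of_isHorizontalOn hq Φ.contMDiff fun a => hP a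
  refine ⟨Φ, fun g b => hqP g b, fun g g' b => ?_, hΦ, hΦ.symm_diffeomorph Φ⟩
  -- The product of `P g` and `P g'` is horizontal and takes the value `g * g'` at `x`, so it is the
  -- transport of `g * g'`.
  have h1 := huniq ((hP g).mul hG h𝓛 (hP g')) x
  simp only [hPx, fiberComp_coe] at h1
  exact congrFun h1 b
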